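/- For $n\ge 1$ and $\sigma\in S_n$ let $\alpha_j(\sigma)$ be the number of cycles of length $j$ of $\sigma$ (fixed points being cycles of length $1$). Let $\hat d(1),\hat d(2),\ldots$ be a fixed sequence of real numbers for which there are constants $d^-,d^+$ with $0<d^-\le \hat d(j)\le d^+<\infty$ for all $j\ge 1$, and let $\hat f(1),\hat f(2),\ldots$ be a fixed sequence of complex numbers such that $|\hat f(j)|\le 1$ for all $j\ge1$ and $\lim_{k\to\infty}\hat f(k)=1$. Define the multiplicative functions $d(\sigma)=\prod_{j=1}^n \hat d(j)^{\alpha_j(\sigma)}$ and $f(\sigma)=\prod_{j=1}^n \hat f(j)^{\alpha_j(\sigma)}$ on $S_n$ (with $0^0=1$), the probability measure $\nu_{n,d}(\sigma)=d(\sigma)/\sum_{\tau\in S_n}d(\tau)$ on $S_n$, and the mean value $M_n^d(f)=\sum_{\sigma\in S_n}f(\sigma)\,\nu_{n,d}(\sigma)$. Then, for every $n\ge 1$, the series $\sum_{j\ge1}\hat d(j)\frac{\hat f(j)-1}{j}e^{-j/n}$ converges absolutely, and \[ M_n^d(f)=\frac{\sum_{\sigma\in S_n}f(\sigma)d(\sigma)}{\sum_{\sigma\in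 S_n}d(\sigma)}=\exp\left\{\sum_{j=1}^{\infty}\hat d(j)\,\frac{\hat f(j)-1}{j}\,e^{-j/n}\right\}+o(1)\qquad\text{as } n\to\infty . \] -/

import Mathlib

open Filter Topology

noncomputable section

/-- The number `α_j(σ)` of cycles of length `j` in the permutation `σ`; fixed points are counted
as cycles of length `1`. -/
def cycleCount {n : ℕ} (σ : Equiv.Perm (Fin n)) (j : ℕ) : ℕ :=
  σ.partition.parts.count j

/-- The multiplicative function on `S_n` attached to the sequence `g 1, g 2, …`:
`σ ↦ g(1)^{α_1(σ)} ⋯ g(n)^{α_n(σ)}`, with `0 ^ 0 = 1`. -/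
def multFun {R : Type*} [CommMonoid R] (g : ℕ → R) {n : ℕ} (σ : Equiv.Perm (Fin n)) : R :=
  ∏ j ∈ Finset.Icc 1 n, g j ^ cycleCount σ j

/-- The measure `ν_{n,d}` on `S_n`: the weight `d(σ) / ∑_τ d(τ)` of the permutation `σ`. -/
def permWeight (d : ℕ → ℝ) {n : ℕ} (σ : Equiv.Perm (Fin n)) : ℝ :=
  multFun d σ / ∑ τ : Equiv.Perm (Fin n), multFun d τ

/-- The mean value `M_n^d(f)` of the multiplicative function `f` with respect to `ν_{n,d}`. -/
def weightedMean (d : ℕ → ℝ) (f : ℕ → ℂ) (n : ℕ) : ℂ :=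
  ∑ σ : Equiv.Perm (Fin n), multFun f σ * (permWeight d σ : ℂ)

/-- The term of index `j` of the series `∑_{j ≥ 1} d(j) (f(j) - 1) / j * e^{-j/n}`. -/
def expSeriesTerm (d : ℕ → ℝ) (f : ℕ → ℂ) (n j : ℕ) : ℂ :=
  (d j : ℂ) * ((f j - 1) / (j : ℂ)) * (Real.exp (-(j : ℝ) / (n : ℝ)) : ℂ)

end

/-! Counting permutations by cycle type shows that `p n = (∑ d(σ)) / n!` and `m n = (∑ d(σ) f(σ)) /
n!` are the Taylor coefficients of P(z) = exp ∑ d(j) z^j / j and of M(z) = P(z) exp H(z), where H(z)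
= ∑ d(j) (f(j) - 1) z^j / j. `IsExpCoeff` encodes this through the logarithmic derivative. The mean
value is `m n / p n`, so with r = e^{-1/N} and A = exp H(r) the claim is m_N - A p_N = o(p_N).

Analytic input. For |w| = 1 the difference M - A P at rw is A P(rw) (exp(H(rw) - H(r)) - 1). Put y =
1 + |w - 1| / (1 - r). The lower bound θ on d gives |P(rw)| ≪ P(r) y^{-θ}
(`IsExpCoeff.norm_tsum_le`). Since d(j) (f(j) - 1) tends to 0, H(rw) - H(r) is at most a small
multiple of log y plus O(|w - 1|) (`norm_tsum_sub_tsum_le`). The decay beats the exponential of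
this, and the product is o(P(r)) uniformly on the circle (`IsExpCoeff.eventually_norm_sub_le`).

Tauberian step. By the recursions, k (m_k - A p_k) is a sum of two convolutions
(`IsExpCoeff.succ_mul_sub`), which Parseval and Cauchy-Schwarz bound on average: ∑_{k ≤ N} k |m_k -
A p_k| = o(N P(r)). The weight k is removed by treating k ≤ N/L trivially, since these k carry only
O(L^{-θ}) P(r). Putting the resulting bound ∑_{k < N} |m_k - A p_k| = o(P(r)) back into the
recursion gives N |m_N - A p_N| = o(P(r)), and P(r) = O(N p_N) by `IsExpCoeff.exists_tsum_le`. -/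

/-! ### Sums over permutations by cycle type -/

/-- The weight `∏ (g j / j) / ∏ α_j!` of the multiset with multiplicities `α_j`. -/
noncomputable def partsWeight {K : Type*} [Field K] (g : ℕ → K) (s : Multiset ℕ) : K :=
  (s.map fun j => g j / j).prod / ∏ j ∈ s.toFinset, ((s.count j).factorial : K)

theorem Multiset.filter_two_le_add_replicate {s : Multiset ℕ} (hs : ∀ i ∈ s, 0 < i) :
    s.filter (fun i => 2 ≤ i) + Multiset.replicate (s.count 1) 1 = s := by
  ext a
  rw [Multiset.count_add, Multiset.count_replicate, Multiset.count_filter]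
  rcases Nat.lt_or_ge a 2 with h | h
  · interval_cases a
    · have : s.count 0 = 0 := Multiset.count_eq_zero.2 fun h => (hs 0 h).ne rfl
      simp [this]
    · simp
  · have : ¬ (1 = a) := by omega
    simp [h, this]

theorem Equiv.Perm.parts_partition_eq_iff {n : ℕ} (σ : Equiv.Perm (Fin n)) {s : Multiset ℕ}
    (hs : ∀ i ∈ s, 0 < i) (hn : s.sum = n) :
    σ.partition.parts = s ↔ σ.cycleType = s.filter (fun i => 2 ≤ i) := by
  constructor
  · rintro rfl
    exact filter_parts_partition_eq_cycleType.symm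
  · intro h
    have h1 := Multiset.filter_two_le_add_replicate hs
    have h2 := congrArg Multiset.sum h1
    rw [Multiset.sum_add, Multiset.sum_replicate, hn, ← h, sum_cycleType] at h2
    rw [parts_partition, h, Fintype.card_fin]
    conv_rhs => rw [← h1]
    congr 2
    simp at h2
    omega

/-- Cauchy's formula with fixed points counted as parts. A `cycleType` omits them, but parts equal
to 1 do not change the product, and the factor `(n - t.sum)!` for the points outside the cycles is
exactly `(s.count 1)!`. -/
theorem Equiv.Perm.card_parts_partition_eq {n : ℕ} {s : Multiset ℕ}
    (hs : ∀ i ∈ s, 0 < i) (hn : s.sum = n) :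
    (Finset.univ.filter fun σ : Equiv.Perm (Fin n) => σ.partition.parts = s).card *
      (s.prod * ∏ j ∈ s.toFinset, (s.count j).factorial) = n.factorial := by
  have h1 := Multiset.filter_two_le_add_replicate hs
  set t := s.filter (fun i => 2 ≤ i) with ht
  have h2 := congrArg Multiset.sum h1
  rw [Multiset.sum_add, Multiset.sum_replicate, hn] at h2
  simp only [smul_eq_mul, mul_one] at h2
  have h3 := Equiv.Perm.card_of_cycleType_mul_eq (Fin n) t
  rw [if_pos ⟨by simp; omega, fun a ha => (Multiset.mem_filter.1 ha).2⟩, Fintype.card_fin] at h3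
  rw [← h3, Finset.filter_congr fun σ _ => Equiv.Perm.parts_partition_eq_iff σ hs hn]
  have h4 : s.prod = t.prod := by
    rw [← h1]; simp
  have h5 : ∏ j ∈ s.toFinset, (s.count j).factorial
      = (n - t.sum).factorial * ∏ j ∈ t.toFinset, (t.count j).factorial := by
    have h6 : n - t.sum = s.count 1 := by omega
    have h7 : 1 ∉ t.toFinset := by simp [ht]
    have h8 : ∏ j ∈ t.toFinset, (t.count j).factorial
        = ∏ j ∈ t.toFinset, (s.count j).factorial := by
      refine Finset.prod_congr rfl fun j hj => ?_
      rw [ht, Multiset.count_filter, if_pos]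
      exact (Multiset.mem_filter.1 (Multiset.mem_toFinset.1 hj)).2
    rw [h6, h8, ← Finset.prod_insert (s := t.toFinset) (f := fun j => (s.count j).factorial) h7]
    refine Finset.prod_subset ?_ ?_
    · intro j hj
      rw [Multiset.mem_toFinset] at hj
      rw [Finset.mem_insert, Multiset.mem_toFinset, ht, Multiset.mem_filter]
      have := hs j hj
      rcases Nat.lt_or_ge j 2 with h | h
      · left; omega
      · exact Or.inr ⟨hj, h⟩
    · intro j _ hj
      rw [Multiset.mem_toFinset] at hj
      rw [Multiset.count_eq_zero.2 hj, Nat.factorial_zero]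
  rw [h4, h5]
  ring

theorem multFun_eq_prod_map {R : Type*} [CommMonoid R] (g : ℕ → R) {n : ℕ}
    (σ : Equiv.Perm (Fin n)) : multFun g σ = (σ.partition.parts.map g).prod := by
  rw [Finset.prod_multiset_map_count]
  refine (Finset.prod_subset ?_ ?_).symm
  · intro j hj
    rw [Multiset.mem_toFinset] at hj
    rw [Finset.mem_Icc]
    refine ⟨σ.partition.parts_pos hj, ?_⟩
    have := Multiset.le_sum_of_mem hj
    rwa [σ.partition.parts_sum, Fintype.card_fin] at this
  · intro j _ hj
    rw [Multiset.mem_toFinset] at hj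
    rw [cycleCount, Multiset.count_eq_zero.2 hj, pow_zero]

theorem sum_multFun_eq {K : Type*} [Field K] [CharZero K] (g : ℕ → K) (n : ℕ) :
    ∑ σ : Equiv.Perm (Fin n), multFun g σ
      = n.factorial * ∑ l : n.Partition, partsWeight g l.parts := by
  -- `σ.partition` is a partition of `Fintype.card (Fin n)`; this moves it to a partition of `n`.
  have key : ∀ σ : Equiv.Perm (Fin n), ∃ l : n.Partition, l.parts = σ.partition.parts := fun σ =>
    ⟨⟨σ.partition.parts, σ.partition.parts_pos, by simpa using σ.partition.parts_sum⟩, rfl⟩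
  choose p hp using key
  rw [← Finset.sum_fiberwise (s := Finset.univ) (g := p), Finset.mul_sum]
  refine Finset.sum_congr rfl fun l _ => ?_
  have h1 : (Finset.univ.filter fun σ => p σ = l)
      = Finset.univ.filter fun σ : Equiv.Perm (Fin n) => σ.partition.parts = l.parts :=
    Finset.filter_congr fun σ _ => by rw [Nat.Partition.ext_iff, hp]
  have h2 : ∀ σ ∈ Finset.univ.filter (fun σ => p σ = l), multFun g σ = (l.parts.map g).prod := by
    intro σ hσ
    rw [multFun_eq_prod_map, ← hp, (Finset.mem_filter.1 hσ).2]
  rw [Finset.sum_congr rfl h2, Finset.sum_const, h1,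
    ← Equiv.Perm.card_parts_partition_eq (fun i hi => l.parts_pos hi) l.parts_sum, partsWeight,
    Multiset.prod_map_div, nsmul_eq_mul]
  have h3 : (l.parts.map (Nat.cast : ℕ → K)).prod ≠ 0 := by
    rw [Ne, Multiset.prod_eq_zero_iff, Multiset.mem_map]
    rintro ⟨a, ha, h⟩
    exact (l.parts_pos ha).ne' (by exact_mod_cast h)
  have h4 : ∏ j ∈ l.parts.toFinset, ((l.parts.count j).factorial : K) ≠ 0 :=
    Finset.prod_ne_zero_iff.2 fun j _ => by exact_mod_cast Nat.factorial_ne_zero _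
  push_cast
  field_simp

/-- A new part j contributes g(j)/j to the product and turns α_j! into (α_j + 1)!, so j times the
new multiplicity clears both denominators. -/
theorem partsWeight_cons {K : Type*} [Field K] [CharZero K] (g : ℕ → K) (s : Multiset ℕ) (i : ℕ) :
    ((i + 1 : ℕ) : K) * ((((i + 1) ::ₘ s).count (i + 1) : ℕ) : K) * partsWeight g ((i + 1) ::ₘ s)
      = g (i + 1) * partsWeight g s := by
  set j := i + 1 with hj
  have h0 : (j : K) ≠ 0 := by rw [hj]; exact_mod_cast Nat.succ_ne_zero i
  have hsub : ∀ t : Multiset ℕ, t.toFinset ⊆ insert j s.toFinset →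
      ∏ k ∈ t.toFinset, ((t.count k).factorial : K)
        = (t.count j).factorial * ∏ k ∈ s.toFinset.erase j, ((t.count k).factorial : K) := by
    intro t ht
    rw [Finset.prod_subset ht (fun k _ hk => by
      rw [Multiset.mem_toFinset] at hk
      rw [Multiset.count_eq_zero.2 hk, Nat.factorial_zero, Nat.cast_one])]
    rw [← Finset.insert_erase (Finset.mem_insert_self j s.toFinset), Finset.prod_insert (by simp)]
    congr 2
    ext k; simp
  unfold partsWeight
  rw [hsub _ (by simp), hsub s (Finset.subset_insert _ _), Multiset.count_cons_self,
    Nat.factorial_succ, Multiset.map_cons, Multiset.prod_cons]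
  have h1 : ∏ k ∈ s.toFinset.erase j, (((j ::ₘ s).count k).factorial : K)
      = ∏ k ∈ s.toFinset.erase j, ((s.count k).factorial : K) :=
    Finset.prod_congr rfl fun k hk => by rw [Multiset.count_cons_of_ne (Finset.ne_of_mem_erase hk)]
  rw [h1]
  have h2 : ∏ k ∈ s.toFinset.erase j, ((s.count k).factorial : K) ≠ 0 :=
    Finset.prod_ne_zero_iff.2 fun j _ => by exact_mod_cast Nat.factorial_ne_zero _
  have h3 : ((s.count j).factorial : K) ≠ 0 := by exact_mod_cast Nat.factorial_ne_zero _
  have h4 : ((s.count j : ℕ) : K) + 1 ≠ 0 := by exact Nat.cast_add_one_ne_zero _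
  push_cast
  field_simp

/-- Double counting: n + 1 is the sum of j α_j over the distinct parts j, and pairs (partition,
distinguished part value j) correspond to partitions of n + 1 - j by deleting one copy of j. -/
theorem sum_partsWeight_succ {K : Type*} [Field K] [CharZero K] (g : ℕ → K) (n : ℕ) :
    ((n : K) + 1) * ∑ l : (n + 1).Partition, partsWeight g l.parts
      = ∑ x ∈ Finset.HasAntidiagonal.antidiagonal n, g (x.1 + 1) * ∑ l : x.2.Partition, partsWeight g l.parts := by
  have h1 : ∀ l : (n + 1).Partition, ((n : K) + 1) * partsWeight g l.parts
      = ∑ j ∈ l.parts.toFinset, (j : K) * (l.parts.count j : K) * partsWeight g l.parts := by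
    intro l
    rw [← Finset.sum_mul]
    congr 1
    have := l.parts_sum
    rw [Finset.sum_multiset_count] at this
    have h := congrArg (Nat.cast : ℕ → K) this
    push_cast at h
    rw [← h]
    exact Finset.sum_congr rfl fun j _ => by rw [nsmul_eq_mul]; push_cast; ring
  rw [Finset.mul_sum, Finset.sum_congr rfl fun l _ => h1 l]
  simp_rw [Finset.mul_sum]
  rw [Finset.sum_sigma', Finset.sum_sigma']
  symm
  refine Finset.sum_bij (fun a ha => ⟨⟨(a.1.1 + 1) ::ₘ a.2.parts, ?_, ?_⟩, a.1.1 + 1⟩) ?_ ?_ ?_ ?_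
  · intro i hi
    rcases Multiset.mem_cons.1 hi with rfl | hi
    · exact Nat.succ_pos _
    · exact a.2.parts_pos hi
  · have := Finset.HasAntidiagonal.mem_antidiagonal.1 (Finset.mem_sigma.1 ha).1
    rw [Multiset.sum_cons, a.2.parts_sum]
    omega
  · intro a ha
    simp
  · rintro ⟨⟨i, k⟩, l⟩ ha ⟨⟨i', k'⟩, l'⟩ ha' h
    have hk := Finset.HasAntidiagonal.mem_antidiagonal.1 (Finset.mem_sigma.1 ha).1
    have hk' := Finset.HasAntidiagonal.mem_antidiagonal.1 (Finset.mem_sigma.1 ha').1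
    simp only [Sigma.mk.injEq, heq_eq_eq, Nat.Partition.mk.injEq] at h
    obtain ⟨h, hi⟩ := h
    obtain rfl : i = i' := by omega
    obtain rfl : k = k' := by simp only at hk hk'; omega
    rw [Multiset.cons_inj_right] at h
    rw [Nat.Partition.ext h]
  · rintro ⟨l, j⟩ hb
    have hj : j ∈ l.parts := by simpa using hb
    have hpos := l.parts_pos hj
    obtain ⟨i, rfl⟩ : ∃ i, j = i + 1 := ⟨j - 1, by omega⟩
    have hs := Multiset.cons_erase hj
    have hsum := l.parts_sum
    rw [← hs, Multiset.sum_cons] at hsum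
    refine ⟨⟨(i, (l.parts.erase (i + 1)).sum),
      ⟨l.parts.erase (i + 1), fun h => l.parts_pos (Multiset.mem_of_mem_erase h), rfl⟩⟩, ?_, ?_⟩
    · simp; omega
    · simp only [Sigma.mk.injEq, heq_eq_eq, and_true]
      exact Nat.Partition.ext hs
  · intro a _
    exact (partsWeight_cons g a.2.parts a.1.1).symm

/-- `n!⁻¹ ∑_σ g(σ)` satisfies the recursion of the coefficients of `exp (∑ g(j) z^j / j)`. -/
theorem sum_multFun_div_factorial_succ {K : Type*} [Field K] [CharZero K] (g : ℕ → K) (n : ℕ) :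
    ((n : K) + 1) * ((∑ σ : Equiv.Perm (Fin (n + 1)), multFun g σ) / (n + 1).factorial)
      = ∑ x ∈ Finset.HasAntidiagonal.antidiagonal n,
          g (x.1 + 1) * ((∑ σ : Equiv.Perm (Fin x.2), multFun g σ) / x.2.factorial) := by
  have h : ∀ k : ℕ, (∑ σ : Equiv.Perm (Fin k), multFun g σ) / (k.factorial : K)
      = ∑ l : k.Partition, partsWeight g l.parts := fun k => by
    rw [sum_multFun_eq, mul_div_cancel_left₀]
    exact_mod_cast Nat.factorial_ne_zero k
  simp_rw [h]
  exact sum_partsWeight_succ g n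

theorem sum_multFun_zero {K : Type*} [Field K] (g : ℕ → K) :
    (∑ σ : Equiv.Perm (Fin 0), multFun g σ) / ((0 : ℕ).factorial : K) = 1 := by
  simp [multFun]

/-! ### Coefficients defined by the recursion -/

/-- `c` is the coefficient sequence of `exp (∑ u i z ^ (i + 1) / (i + 1))`, as expressed by the
recursion coming from the logarithmic derivative. -/
def IsExpCoeff {K : Type*} [Field K] (u c : ℕ → K) : Prop :=
  c 0 = 1 ∧ ∀ n : ℕ, ((n : K) + 1) * c (n + 1)
    = ∑ x ∈ Finset.HasAntidiagonal.antidiagonal n, u x.1 * c x.2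

/-- The recursion has nonnegative structure, so domination of the logarithmic coefficients passes to
the coefficients by induction. This makes `p` a majorant of `m`. -/
theorem IsExpCoeff.norm_le {u c : ℕ → ℂ} {v p : ℕ → ℝ} (hc : IsExpCoeff u c)
    (hp : IsExpCoeff v p) (h : ∀ i, ‖u i‖ ≤ v i) (n : ℕ) : ‖c n‖ ≤ p n := by
  induction n using Nat.strong_induction_on with
  | _ n ih =>
    rcases n with _ | n
    · rw [hc.1, hp.1, norm_one]
    · have h1 : ‖((n : ℂ) + 1) * c (n + 1)‖ = ((n : ℝ) + 1) * ‖c (n + 1)‖ := by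
        rw [norm_mul]
        congr 1
        exact_mod_cast Complex.norm_natCast (n + 1)
      have h2 : ‖((n : ℂ) + 1) * c (n + 1)‖ ≤ ((n : ℝ) + 1) * p (n + 1) := by
        rw [hc.2, hp.2]
        refine (norm_sum_le _ _).trans (Finset.sum_le_sum fun x hx => ?_)
        have hx := Finset.HasAntidiagonal.mem_antidiagonal.1 hx
        rw [norm_mul]
        exact mul_le_mul (h _) (ih _ (by omega)) (norm_nonneg _) ((norm_nonneg _).trans (h _))
      rw [h1] at h2
      exact le_of_mul_le_mul_left h2 (by positivity)

theorem IsExpCoeff.pos {v p : ℕ → ℝ} (hp : IsExpCoeff v p) (hv : ∀ i, 0 < v i) (n : ℕ) :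
    0 < p n := by
  induction n using Nat.strong_induction_on with
  | _ n ih =>
    rcases n with _ | n
    · rw [hp.1]; exact one_pos
    · have h2 : 0 < ((n : ℝ) + 1) * p (n + 1) := by
        rw [hp.2]
        refine Finset.sum_pos (fun x hx => ?_) ⟨(0, n), by simp⟩
        have hx := Finset.HasAntidiagonal.mem_antidiagonal.1 hx
        exact mul_pos (hv _) (ih _ (by omega))
      exact pos_of_mul_pos_right h2 (by positivity)

theorem Finset.sum_antidiagonal_snd {M : Type*} [AddCommMonoid M] (f : ℕ → M) (n : ℕ) :
    ∑ x ∈ Finset.HasAntidiagonal.antidiagonal n, f x.2 = ∑ k ∈ Finset.range (n + 1), f k := by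
  rw [← Finset.Nat.sum_antidiagonal_swap, Finset.Nat.sum_antidiagonal_eq_sum_range_succ_mk]
  simp only [Prod.snd_swap, Nat.succ_eq_add_one]

theorem IsExpCoeff.succ_mul_le {v p : ℕ → ℝ} {B : ℝ} (hp : IsExpCoeff v p) (hv : ∀ i, 0 < v i)
    (hB : ∀ i, v i ≤ B) (n : ℕ) :
    ((n : ℝ) + 1) * p (n + 1) ≤ B * ∑ k ∈ Finset.range (n + 1), p k := by
  rw [hp.2, ← Finset.sum_antidiagonal_snd, Finset.mul_sum]
  exact Finset.sum_le_sum fun x _ => mul_le_mul_of_nonneg_right (hB _) (hp.pos hv _).le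

theorem IsExpCoeff.le_succ_mul {v p : ℕ → ℝ} {b : ℝ} (hp : IsExpCoeff v p) (hv : ∀ i, 0 < v i)
    (hb : ∀ i, b ≤ v i) (n : ℕ) :
    b * ∑ k ∈ Finset.range (n + 1), p k ≤ ((n : ℝ) + 1) * p (n + 1) := by
  rw [hp.2, ← Finset.sum_antidiagonal_snd, Finset.mul_sum]
  exact Finset.sum_le_sum fun x _ => mul_le_mul_of_nonneg_right (hb _) (hp.pos hv _).le

theorem IsExpCoeff.sum_succ_le {v p : ℕ → ℝ} {B : ℝ} (hp : IsExpCoeff v p) (hv : ∀ i, 0 < v i)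
    (hB : ∀ i, v i ≤ B) (n : ℕ) :
    ∑ k ∈ Finset.range (n + 2), p k
      ≤ (1 + B / ((n : ℝ) + 1)) * ∑ k ∈ Finset.range (n + 1), p k := by
  have h := hp.succ_mul_le hv hB n
  have h2 : p (n + 1) ≤ B / ((n : ℝ) + 1) * ∑ k ∈ Finset.range (n + 1), p k := by
    rw [div_mul_eq_mul_div, le_div_iff₀ (by positivity), mul_comm]
    exact h
  rw [Finset.sum_range_succ]
  linarith

/-- The partial sums of `p` grow by a factor at most 1 + B/(n+1), which tends to 1, so the ratio
test applies to them; it need not apply to `p` itself. -/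
theorem IsExpCoeff.summable_real {v p : ℕ → ℝ} {B r : ℝ} (hp : IsExpCoeff v p)
    (hv : ∀ i, 0 < v i) (hB : ∀ i, v i ≤ B) (hr0 : 0 ≤ r) (hr : r < 1) :
    Summable fun n => p n * r ^ n := by
  have hS : ∀ n, 0 < ∑ k ∈ Finset.range (n + 1), p k := fun n =>
    Finset.sum_pos (fun k _ => hp.pos hv k) ⟨0, by simp⟩
  have hsum : Summable fun n => (∑ k ∈ Finset.range (n + 1), p k) * r ^ n := by
    refine summable_of_ratio_norm_eventually_le (r := (1 + r) / 2) (by linarith) ?_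
    have ht : Tendsto (fun n : ℕ => (1 + B / ((n : ℝ) + 1)) * r) atTop (𝓝 ((1 + 0) * r)) := by
      refine (Tendsto.const_add _ ?_).mul_const _
      have h := (tendsto_one_div_add_atTop_nhds_zero_nat (𝕜 := ℝ)).const_mul B
      simpa only [mul_one_div, mul_zero] using h
    have hev := ht.eventually (gt_mem_nhds (show (1 + 0) * r < (1 + r) / 2 by linarith))
    filter_upwards [hev] with n hn
    have h1 := hp.sum_succ_le hv hB n
    rw [Real.norm_of_nonneg (mul_nonneg (hS _).le (pow_nonneg hr0 _)),
      Real.norm_of_nonneg (mul_nonneg (hS _).le (pow_nonneg hr0 _))]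
    calc (∑ k ∈ Finset.range (n + 1 + 1), p k) * r ^ (n + 1)
        ≤ ((1 + B / ((n : ℝ) + 1)) * ∑ k ∈ Finset.range (n + 1), p k) * r ^ (n + 1) :=
          mul_le_mul_of_nonneg_right h1 (pow_nonneg hr0 _)
      _ = ((1 + B / ((n : ℝ) + 1)) * r) * ((∑ k ∈ Finset.range (n + 1), p k) * r ^ n) := by ring
      _ ≤ _ := mul_le_mul_of_nonneg_right hn.le (mul_nonneg (hS _).le (pow_nonneg hr0 _))
  refine Summable.of_nonneg_of_le (fun n => mul_nonneg (hp.pos hv n).le (pow_nonneg hr0 _))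
    (fun n => mul_le_mul_of_nonneg_right ?_ (pow_nonneg hr0 _)) hsum
  exact Finset.single_le_sum (f := p) (fun k _ => (hp.pos hv k).le) (by simp)

theorem IsExpCoeff.summable {u c : ℕ → ℂ} {v p : ℕ → ℝ} {B r : ℝ} (hc : IsExpCoeff u c)
    (hp : IsExpCoeff v p) (hv : ∀ i, 0 < v i) (hB : ∀ i, v i ≤ B) (h : ∀ i, ‖u i‖ ≤ v i)
    (hr0 : 0 ≤ r) (hr : r < 1) :
    Summable fun n => ‖c n‖ * r ^ n :=
  (hp.summable_real hv hB hr0 hr).of_nonneg_of_le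
    (fun _ => mul_nonneg (norm_nonneg _) (pow_nonneg hr0 _))
    fun n => mul_le_mul_of_nonneg_right (hc.norm_le hp h n) (pow_nonneg hr0 _)

/-! ### The generating function as an exponential -/

theorem summable_norm_mul_pow_of_bounded {u : ℕ → ℂ} {B r : ℝ} (hB : ∀ i, ‖u i‖ ≤ B)
    (hr0 : 0 ≤ r) (hr : r < 1) : Summable fun n => ‖u n‖ * r ^ n :=
  ((summable_geometric_of_lt_one hr0 hr).mul_left B).of_nonneg_of_le
    (fun _ => mul_nonneg (norm_nonneg _) (pow_nonneg hr0 _))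
    fun n => mul_le_mul_of_nonneg_right (hB n) (pow_nonneg hr0 _)

theorem hasDerivAt_tsum_mul_pow_succ_div {v : ℕ → ℂ} {z : ℂ} {ρ : ℝ} (hz : ‖z‖ < ρ)
    (h : Summable fun n => ‖v n‖ * ρ ^ n) :
    HasDerivAt (fun w => ∑' n : ℕ, v n * w ^ (n + 1) / ((n : ℂ) + 1)) (∑' n : ℕ, v n * z ^ n)
      z := by
  have hρ : 0 < ρ := (norm_nonneg z).trans_lt hz
  refine hasDerivAt_tsum_of_isPreconnected
    (g := fun (n : ℕ) (w : ℂ) => v n * w ^ (n + 1) / ((n : ℂ) + 1))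
    (g' := fun (n : ℕ) (w : ℂ) => v n * w ^ n) (t := Metric.ball (0 : ℂ) ρ) (y₀ := 0) h
    Metric.isOpen_ball (convex_ball _ _).isPreconnected (fun n y _ => ?_) (fun n y hy => ?_)
    (by simpa using hρ) ?_ (by simpa using hz)
  · have h1 := ((hasDerivAt_pow (n + 1) y).const_mul (v n)).div_const ((n : ℂ) + 1)
    refine h1.congr_deriv ?_
    have : ((n : ℂ) + 1) ≠ 0 := Nat.cast_add_one_ne_zero n
    push_cast
    field_simp
  · rw [norm_mul, norm_pow]
    have hy : ‖y‖ < ρ := by simpa using hy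
    gcongr
  · simp

theorem norm_mul_pow_eq {c : ℕ → ℂ} {r : ℝ} (hr0 : 0 ≤ r) (n : ℕ) :
    ‖c n * (r : ℂ) ^ n‖ = ‖c n‖ * r ^ n := by
  rw [norm_mul, norm_pow, Complex.norm_real, Real.norm_of_nonneg hr0]

theorem sum_antidiagonal_mul_pow (a b : ℕ → ℂ) (z : ℂ) (n : ℕ) :
    ∑ x ∈ Finset.HasAntidiagonal.antidiagonal n, (a x.1 * z ^ x.1) * (b x.2 * z ^ x.2)
      = (∑ x ∈ Finset.HasAntidiagonal.antidiagonal n, a x.1 * b x.2) * z ^ n := by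
  rw [Finset.sum_mul]
  refine Finset.sum_congr rfl fun x hx => ?_
  rw [← Finset.HasAntidiagonal.mem_antidiagonal.1 hx]
  ring

/-- The generating function of the sequence `c` is the exponential of the logarithmic series. -/
theorem IsExpCoeff.tsum_eq_exp {u c : ℕ → ℂ} {B : ℝ} (hc : IsExpCoeff u c)
    (hu : ∀ i, ‖u i‖ ≤ B)
    (hs : ∀ r : ℝ, 0 ≤ r → r < 1 → Summable fun n => ‖c n‖ * r ^ n) {z : ℂ} (hz : ‖z‖ < 1) :
    ∑' n, c n * z ^ n = Complex.exp (∑' n : ℕ, u n * z ^ (n + 1) / ((n : ℂ) + 1)) := by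
  set U : ℂ → ℂ := fun w => ∑' n, u n * w ^ n with hU
  set C : ℂ → ℂ := fun w => ∑' n, c n * w ^ n with hC
  set T : ℂ → ℂ := fun w => ∑' n : ℕ, u n * w ^ (n + 1) / ((n : ℂ) + 1) with hT
  have hnorm : ∀ (a : ℕ → ℂ) (w : ℂ), (fun n => ‖a n * w ^ n‖) = fun n => ‖a n‖ * ‖w‖ ^ n := by
    intro a w; ext n; rw [norm_mul, norm_pow]
  have hdT : ∀ w : ℂ, ‖w‖ < 1 → HasDerivAt T (U w) w := by
    intro w hw
    obtain ⟨ρ, h1, h2⟩ := exists_between hw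
    exact hasDerivAt_tsum_mul_pow_succ_div h1
      (summable_norm_mul_pow_of_bounded hu ((norm_nonneg w).trans h1.le) h2)
  have hdC : ∀ w : ℂ, ‖w‖ < 1 → HasDerivAt C (U w * C w) w := by
    intro w hw
    obtain ⟨ρ, h1, h2⟩ := exists_between hw
    have hρ : 0 ≤ ρ := (norm_nonneg w).trans h1.le
    -- By the recursion, the coefficients of the derivative form a Cauchy product of two absolutely
    -- convergent series.
    have hsc : Summable fun n : ℕ => ‖((n : ℂ) + 1) * c (n + 1)‖ * ρ ^ n := by
      have h3 := summable_norm_sum_mul_antidiagonal_of_summable_norm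
        (f := fun n => u n * (ρ : ℂ) ^ n) (g := fun n => c n * (ρ : ℂ) ^ n)
        (by simpa only [norm_mul_pow_eq hρ] using summable_norm_mul_pow_of_bounded hu hρ h2)
        (by simpa only [norm_mul_pow_eq hρ] using hs ρ hρ h2)
      refine h3.congr fun n => ?_
      rw [sum_antidiagonal_mul_pow, ← hc.2]
      exact norm_mul_pow_eq (c := fun n => ((n : ℂ) + 1) * c (n + 1)) hρ n
    have h4 := (hasDerivAt_tsum_mul_pow_succ_div h1 hsc).const_add 1
    have h5 : ∑' n : ℕ, ((n : ℂ) + 1) * c (n + 1) * w ^ n = U w * C w := by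
      rw [hU, hC]
      simp only
      rw [tsum_mul_tsum_eq_tsum_sum_antidiagonal_of_summable_norm]
      · refine tsum_congr fun n => ?_
        rw [sum_antidiagonal_mul_pow, hc.2]
      · rw [hnorm]; exact summable_norm_mul_pow_of_bounded hu (norm_nonneg w) hw
      · rw [hnorm]; exact hs _ (norm_nonneg w) hw
    rw [h5] at h4
    refine h4.congr_of_eventuallyEq ?_
    filter_upwards [Metric.isOpen_ball.mem_nhds (show w ∈ Metric.ball (0 : ℂ) 1 by simpa using hw)]
      with y hy
    have hy : ‖y‖ < 1 := by simpa using hy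
    have h6 : Summable fun n => c n * y ^ n :=
      Summable.of_norm (by rw [hnorm]; exact hs _ (norm_nonneg y) hy)
    simp only [hC]
    rw [h6.tsum_eq_zero_add, hc.1, pow_zero, mul_one]
    congr 1
    refine tsum_congr fun n => ?_
    have : ((n : ℂ) + 1) ≠ 0 := Nat.cast_add_one_ne_zero n
    field_simp
  -- C' = U C and T' = U make exp(-T) C constant on the disc, with value 1 at the origin.
  have hd : ∀ w ∈ Metric.ball (0 : ℂ) 1,
      HasDerivAt (fun w => Complex.exp (-T w) * C w) 0 w := by
    intro w hw
    have hw : ‖w‖ < 1 := by simpa using hw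
    refine (((hdT w hw).neg.cexp).mul (hdC w hw)).congr_deriv ?_
    ring
  have hconst := Metric.isOpen_ball.is_const_of_deriv_eq_zero
    (convex_ball (0 : ℂ) 1).isPreconnected
    (fun w hw => (hd w hw).differentiableAt.differentiableWithinAt)
    (fun w hw => (hd w hw).deriv) (show z ∈ Metric.ball (0 : ℂ) 1 by simpa using hz)
    (Metric.mem_ball_self one_pos)
  have hC0 : C 0 = 1 := by
    simp only [hC]
    rw [tsum_eq_single 0 (fun n hn => by simp [hn])]
    simp [hc.1]
  have hT0 : T 0 = 0 := by simp [hT]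
  simp only [hC0, hT0, neg_zero, Complex.exp_zero, mul_one] at hconst
  calc C z = Complex.exp (T z) * (Complex.exp (-T z) * C z) := by
        rw [← mul_assoc, ← Complex.exp_add]; simp
    _ = _ := by rw [hconst, mul_one]

/-! ### Parseval on the circle -/

open MeasureTheory AddCircle in
/-- The value of `∑ |c n|²` as a mean square over the circle. -/
theorem exists_continuousMap_fourier {c : ℕ → ℂ} (hc : Summable fun n => ‖c n‖)
    [Fact (0 < 2 * Real.pi)] :
    ∃ F : C(AddCircle (2 * Real.pi), ℂ),
      (∀ t, F t = ∑' n : ℕ, c n * (toCircle t : ℂ) ^ n) ∧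
      HasSum (fun n => ‖c n‖ ^ 2) (∫ t, ‖F t‖ ^ 2 ∂haarAddCircle) := by
  have hs : Summable fun n : ℕ => c n • (fourier (n : ℤ) : C(AddCircle (2 * Real.pi), ℂ)) := by
    refine Summable.of_norm ?_
    simpa only [norm_smul, fourier_norm, mul_one] using hc
  set F := ∑' n : ℕ, c n • (fourier (n : ℤ) : C(AddCircle (2 * Real.pi), ℂ)) with hF
  have hval : ∀ t, F t = ∑' n : ℕ, c n * (toCircle t : ℂ) ^ n := by
    intro t
    refine ((ContinuousMap.evalCLM ℂ t).hasSum hs.hasSum).tsum_eq.symm.trans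
      (tsum_congr fun n => ?_)
    simp [fourier_apply, toCircle_nsmul]
  refine ⟨F, hval, ?_⟩
  have hL2 : HasSum (fun n : ℕ => c n • fourierLp (T := 2 * Real.pi) 2 (n : ℤ))
      (ContinuousMap.toLp (E := ℂ) 2 haarAddCircle ℂ F) := by
    have := (ContinuousMap.toLp (E := ℂ) 2 (haarAddCircle (T := 2 * Real.pi)) ℂ).hasSum hs.hasSum
    simpa only [map_smul] using this
  have hcoef : ∀ m : ℤ, fourierCoeff F m = if 0 ≤ m then c m.toNat else 0 := by
    intro m
    rw [← fourierCoeff_toLp, ← fourierBasis_repr, HilbertBasis.repr_apply_apply, coe_fourierBasis]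
    have h1 := (innerSL ℂ (fourierLp (T := 2 * Real.pi) 2 m)).hasSum hL2
    rw [innerSL_apply_apply] at h1
    refine h1.unique ?_
    have horth := orthonormal_iff_ite.1 (orthonormal_fourier (T := 2 * Real.pi))
    simp only [map_smul, innerSL_apply_apply, horth, smul_eq_mul, mul_ite, mul_one, mul_zero]
    split_ifs with hm
    · have h : (fun n : ℕ => if m = n then c n else 0)
          = fun n : ℕ => if n = m.toNat then c m.toNat else 0 := by
        ext n
        by_cases h : m = n
        · rw [if_pos h, if_pos (by omega), h, Int.toNat_natCast]
        · rw [if_neg h, if_neg (by omega)]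
      rw [h]
      exact hasSum_ite_eq _ _
    · have h : (fun n : ℕ => if m = n then c n else 0) = fun _ : ℕ => (0 : ℂ) := by
        ext n
        rw [if_neg (by omega)]
      rw [h]
      exact hasSum_zero
  have h2 := hasSum_sq_fourierCoeff (ContinuousMap.toLp (E := ℂ) 2 haarAddCircle ℂ F)
  have h3 : ∫ t, ‖(ContinuousMap.toLp (E := ℂ) 2 haarAddCircle ℂ F) t‖ ^ 2 ∂haarAddCircle
      = ∫ t, ‖F t‖ ^ 2 ∂haarAddCircle := by
    refine integral_congr_ae ?_
    filter_upwards [ContinuousMap.coeFn_toLp (p := 2) (𝕜 := ℂ) haarAddCircle F] with t ht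
    rw [ht]
  rw [h3] at h2
  simp_rw [fourierCoeff_toLp, hcoef] at h2
  rw [← Function.Injective.hasSum_iff (g := (Nat.cast : ℕ → ℤ)) Nat.cast_injective] at h2
  · simpa [Function.comp_def] using h2
  · intro m hm
    rw [if_neg]
    · simp
    · intro h
      exact hm ⟨m.toNat, by simp [h]⟩

open MeasureTheory AddCircle in
/-- Multiplication by a function bounded by `B` on the unit circle does not increase the
`ℓ²`-norm of the coefficients by more than the factor `B`. -/
theorem sum_norm_sq_antidiagonal_le {a b : ℕ → ℂ} (ha : Summable fun n => ‖a n‖)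
    (hb : Summable fun n => ‖b n‖) {B : ℝ}
    (hB : ∀ w : ℂ, ‖w‖ = 1 → ‖∑' n, b n * w ^ n‖ ≤ B) (s : Finset ℕ) :
    ∑ n ∈ s, ‖∑ x ∈ Finset.HasAntidiagonal.antidiagonal n, a x.1 * b x.2‖ ^ 2
      ≤ B ^ 2 * ∑' n, ‖a n‖ ^ 2 := by
  have : Fact (0 < 2 * Real.pi) := ⟨Real.two_pi_pos⟩
  obtain ⟨F, hF, hFs⟩ := exists_continuousMap_fourier ha
  obtain ⟨H, hH, hHs⟩ := exists_continuousMap_fourier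
    (summable_norm_sum_mul_antidiagonal_of_summable_norm ha hb)
  have hmul : ∀ t, ‖H t‖ ^ 2 ≤ B ^ 2 * ‖F t‖ ^ 2 := by
    intro t
    have hw : ‖(toCircle t : ℂ)‖ = 1 := Circle.norm_coe _
    have h1 : H t = F t * ∑' n, b n * (toCircle t : ℂ) ^ n := by
      rw [hF, hH, tsum_mul_tsum_eq_tsum_sum_antidiagonal_of_summable_norm
        (by simpa only [norm_mul, norm_pow, hw, one_pow, mul_one] using ha)
        (by simpa only [norm_mul, norm_pow, hw, one_pow, mul_one] using hb)]
      exact tsum_congr fun n => (sum_antidiagonal_mul_pow a b _ n).symm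
    rw [h1, norm_mul, mul_pow, mul_comm]
    gcongr
    exact hB _ hw
  have hint : ∀ G : C(AddCircle (2 * Real.pi), ℂ),
      Integrable (fun t => ‖G t‖ ^ 2) (haarAddCircle (T := 2 * Real.pi)) := fun G => by
    have : Continuous fun t => ‖G t‖ ^ 2 := by fun_prop
    simpa using this.continuousOn.integrableOn_compact (μ := haarAddCircle) isCompact_univ
  calc _ ≤ ∫ t, ‖H t‖ ^ 2 ∂haarAddCircle := sum_le_hasSum s (fun _ _ => by positivity) hHs
    _ ≤ ∫ t, B ^ 2 * ‖F t‖ ^ 2 ∂haarAddCircle :=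
        integral_mono (hint H) ((hint F).const_mul _) hmul
    _ = B ^ 2 * ∑' n, ‖a n‖ ^ 2 := by rw [integral_const_mul, hFs.tsum_eq]

/-! ### Growth of a positive coefficient sequence -/

theorem IsExpCoeff.ofReal {v p : ℕ → ℝ} (hp : IsExpCoeff v p) :
    IsExpCoeff (fun i => (v i : ℂ)) (fun n => (p n : ℂ)) := by
  refine ⟨by simp only [hp.1, Complex.ofReal_one], fun n => ?_⟩
  have := congrArg (fun x : ℝ => (x : ℂ)) (hp.2 n)
  push_cast at this
  exact this

theorem summable_mul_pow_succ_div {u : ℕ → ℂ} {B : ℝ} {z : ℂ} (hu : ∀ i, ‖u i‖ ≤ B)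
    (hz : ‖z‖ < 1) : Summable fun n : ℕ => u n * z ^ (n + 1) / ((n : ℂ) + 1) := by
  refine Summable.of_norm_bounded (summable_norm_mul_pow_of_bounded hu (norm_nonneg z) hz)
    fun n => ?_
  have h1 : ‖(n : ℂ) + 1‖ = (n : ℝ) + 1 := by exact_mod_cast Complex.norm_natCast (n + 1)
  rw [norm_div, norm_mul, norm_pow, h1, pow_succ]
  have h2 : 0 ≤ ‖u n‖ * ‖z‖ ^ n := by positivity
  rw [div_le_iff₀ (by positivity), ← mul_assoc]
  have h3 : (0 : ℝ) ≤ n := n.cast_nonneg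
  nlinarith [mul_nonneg h2 h3, mul_nonneg h2 (sub_nonneg.2 hz.le)]

theorem summable_real_mul_pow_succ_div {v : ℕ → ℝ} {B r : ℝ} (hv : ∀ i, |v i| ≤ B)
    (hr0 : 0 ≤ r) (hr : r < 1) : Summable fun n : ℕ => v n * r ^ (n + 1) / ((n : ℝ) + 1) := by
  have h := summable_mul_pow_succ_div (u := fun i => (v i : ℂ)) (z := (r : ℂ)) (B := B)
    (by simpa using hv) (by simpa [abs_of_nonneg hr0] using hr)
  exact_mod_cast h

theorem tsum_ofReal_mul_pow {p : ℕ → ℝ} (r : ℝ) :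
    ∑' n, (p n : ℂ) * (r : ℂ) ^ n = ((∑' n, p n * r ^ n : ℝ) : ℂ) := by
  push_cast; rfl

section Majorant

variable {v p : ℕ → ℝ} {θ B : ℝ}

theorem IsExpCoeff.norm_tsum_eq_exp_re (hp : IsExpCoeff v p) (hv : ∀ i, 0 < v i)
    (hB : ∀ i, v i ≤ B) {z : ℂ} (hz : ‖z‖ < 1) :
    ‖∑' n, (p n : ℂ) * z ^ n‖
      = Real.exp (∑' n : ℕ, ((v n : ℂ) * z ^ (n + 1) / ((n : ℂ) + 1)).re) := by
  have hb : ∀ i, ‖(v i : ℂ)‖ ≤ B := fun i => by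
    rw [Complex.norm_real, Real.norm_of_nonneg (hv i).le]; exact hB i
  rw [hp.ofReal.tsum_eq_exp hb (fun r h0 h1 => hp.ofReal.summable hp hv hB
    (fun i => by rw [Complex.norm_real, Real.norm_of_nonneg (hv i).le]) h0 h1) hz,
    Complex.norm_exp, Complex.re_tsum (summable_mul_pow_succ_div hb hz)]

theorem IsExpCoeff.tsum_eq_real_exp (hp : IsExpCoeff v p) (hv : ∀ i, 0 < v i)
    (hB : ∀ i, v i ≤ B) {r : ℝ} (hr0 : 0 ≤ r) (hr : r < 1) :
    ∑' n, p n * r ^ n = Real.exp (∑' n : ℕ, v n * r ^ (n + 1) / ((n : ℝ) + 1)) := by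
  have hb : ∀ i, ‖(v i : ℂ)‖ ≤ B := fun i => by
    rw [Complex.norm_real, Real.norm_of_nonneg (hv i).le]; exact hB i
  have h := hp.ofReal.tsum_eq_exp hb (fun r h0 h1 => hp.ofReal.summable hp hv hB
    (fun i => by rw [Complex.norm_real, Real.norm_of_nonneg (hv i).le]) h0 h1) (z := (r : ℂ))
    (by simpa [abs_of_nonneg hr0] using hr)
  exact_mod_cast h

theorem norm_one_sub_pos {z : ℂ} (hz : ‖z‖ < 1) : 0 < ‖1 - z‖ := by
  have := norm_sub_norm_le (1 : ℂ) z
  rw [norm_one] at this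
  linarith

/-- Decay of the generating function away from the positive real axis. -/
theorem IsExpCoeff.norm_tsum_le (hp : IsExpCoeff v p) (hθ : 0 < θ) (hvθ : ∀ i, θ ≤ v i)
    (hB : ∀ i, v i ≤ B) {z : ℂ} {r : ℝ} (hz : ‖z‖ ≤ r) (hr : r < 1) :
    ‖∑' n, (p n : ℂ) * z ^ n‖ ≤ (∑' n, p n * r ^ n) * ((1 - r) / ‖1 - z‖) ^ θ := by
  have hv : ∀ i, 0 < v i := fun i => hθ.trans_le (hvθ i)
  have hr0 : 0 ≤ r := (norm_nonneg z).trans hz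
  have hz1 : ‖z‖ < 1 := hz.trans_lt hr
  have hb : ∀ i, ‖(v i : ℂ)‖ ≤ B := fun i => by
    rw [Complex.norm_real, Real.norm_of_nonneg (hv i).le]; exact hB i
  have hz0 := norm_one_sub_pos hz1
  rw [hp.norm_tsum_eq_exp_re hv hB hz1, hp.tsum_eq_real_exp hv hB hr0 hr,
    Real.rpow_def_of_pos (div_pos (by linarith) hz0), ← Real.exp_add, Real.exp_le_exp,
    Real.log_div (by linarith) hz0.ne']
  have s1 : Summable fun n : ℕ => ((v n : ℂ) * z ^ (n + 1) / ((n : ℂ) + 1)).re :=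
    Complex.reCLM.summable (summable_mul_pow_succ_div hb hz1)
  have s2 := summable_real_mul_pow_succ_div (v := v) (B := B)
    (fun i => by rw [abs_of_pos (hv i)]; exact hB i) hr0 hr
  have s3 : HasSum (fun n : ℕ => r ^ (n + 1) / ((n : ℝ) + 1)) (-Real.log (1 - r)) :=
    Real.hasSum_pow_div_log_of_abs_lt_one (by rwa [abs_of_nonneg hr0])
  have s4 : HasSum (fun n : ℕ => (z ^ (n + 1) / ((n : ℂ) + 1)).re) (-Real.log ‖1 - z‖) := by
    have := Complex.hasSum_re (Complex.hasSum_taylorSeries_neg_log' hz1)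
    rwa [Complex.neg_re, Complex.log_re] at this
  -- The difference of the logarithms is ∑ v_n (r^{n+1} - Re z^{n+1}) / (n+1), with nonnegative
  -- brackets, so v_n may be lowered to θ; the series then sums to θ log(‖1 - z‖ / (1 - r)).
  have s5 := (s3.sub s4).mul_left θ
  have h := hasSum_le (fun n => ?_) s5 (s2.sub s1).hasSum
  · rw [s2.tsum_sub s1] at h
    linarith
  · have h1 : ((v n : ℂ) * z ^ (n + 1) / ((n : ℂ) + 1)).re
        = v n * (z ^ (n + 1) / ((n : ℂ) + 1)).re := by
      rw [mul_div_assoc, Complex.re_ofReal_mul]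
    rw [h1, mul_div_assoc, ← mul_sub]
    refine mul_le_mul_of_nonneg_right (hvθ n) (sub_nonneg.2 ?_)
    refine (Complex.re_le_norm _).trans ?_
    have h2 : ‖(n : ℂ) + 1‖ = (n : ℝ) + 1 := by exact_mod_cast Complex.norm_natCast (n + 1)
    rw [norm_div, norm_pow, h2]
    gcongr

theorem IsExpCoeff.tsum_nonneg (hp : IsExpCoeff v p) (hv : ∀ i, 0 < v i) {r : ℝ} (hr0 : 0 ≤ r) :
    0 ≤ ∑' n, p n * r ^ n :=
  _root_.tsum_nonneg fun n => mul_nonneg (hp.pos hv n).le (pow_nonneg hr0 n)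

theorem IsExpCoeff.tsum_le_of_le (hp : IsExpCoeff v p) (hθ : 0 < θ) (hvθ : ∀ i, θ ≤ v i)
    (hB : ∀ i, v i ≤ B) {r s : ℝ} (hs0 : 0 ≤ s) (hsr : s ≤ r) (hr : r < 1) :
    ∑' n, p n * s ^ n ≤ (∑' n, p n * r ^ n) * ((1 - r) / (1 - s)) ^ θ := by
  have h := hp.norm_tsum_le hθ hvθ hB (z := (s : ℂ)) (r := r)
    (by simpa [abs_of_nonneg hs0] using hsr) hr
  have h1 : ‖(1 : ℂ) - s‖ = 1 - s := by
    rw [← Complex.ofReal_one, ← Complex.ofReal_sub, Complex.norm_real, Real.norm_of_nonneg]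
    linarith
  rwa [tsum_ofReal_mul_pow, Complex.norm_real, h1, Real.norm_of_nonneg
    (hp.tsum_nonneg (fun i => hθ.trans_le (hvθ i)) hs0)] at h

/-- On the real axis the terms r^{n+1} - s^{n+1} are nonnegative, so `v` may be raised to B in the
exponent. -/
theorem IsExpCoeff.tsum_le_of_ge (hp : IsExpCoeff v p) (hv : ∀ i, 0 < v i)
    (hB : ∀ i, v i ≤ B) {r s : ℝ} (hs0 : 0 ≤ s) (hsr : s ≤ r) (hr : r < 1) :
    ∑' n, p n * r ^ n ≤ (∑' n, p n * s ^ n) * ((1 - s) / (1 - r)) ^ B := by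
  have hs : s < 1 := hsr.trans_lt hr
  have hr0 : 0 ≤ r := hs0.trans hsr
  rw [hp.tsum_eq_real_exp hv hB hr0 hr, hp.tsum_eq_real_exp hv hB hs0 hs,
    Real.rpow_def_of_pos (div_pos (by linarith) (by linarith)), ← Real.exp_add, Real.exp_le_exp,
    Real.log_div (by linarith) (by linarith)]
  have hv' : ∀ i, |v i| ≤ B := fun i => by rw [abs_of_pos (hv i)]; exact hB i
  have s1 := summable_real_mul_pow_succ_div hv' hs0 hs
  have s2 := summable_real_mul_pow_succ_div hv' hr0 hr
  have s3 : HasSum (fun n : ℕ => r ^ (n + 1) / ((n : ℝ) + 1)) (-Real.log (1 - r)) :=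
    Real.hasSum_pow_div_log_of_abs_lt_one (by rwa [abs_of_nonneg hr0])
  have s4 : HasSum (fun n : ℕ => s ^ (n + 1) / ((n : ℝ) + 1)) (-Real.log (1 - s)) :=
    Real.hasSum_pow_div_log_of_abs_lt_one (by rwa [abs_of_nonneg hs0])
  have h := hasSum_le (fun n => ?_) (s2.sub s1).hasSum ((s3.sub s4).mul_left B)
  · rw [s2.tsum_sub s1] at h
    linarith
  · rw [mul_div_assoc, mul_div_assoc, ← mul_sub]
    refine mul_le_mul_of_nonneg_right (hB n) (sub_nonneg.2 ?_)
    gcongr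

theorem IsExpCoeff.sum_range_add_le (hp : IsExpCoeff v p) (hv : ∀ i, 0 < v i)
    (hB : ∀ i, v i ≤ B) {N : ℕ} (hN : 1 ≤ N) (i : ℕ) :
    ∑ k ∈ Finset.range (N + i), p k ≤ (1 + B / N) ^ i * ∑ k ∈ Finset.range N, p k := by
  have hB0 : 0 < B := (hv 0).trans_le (hB 0)
  induction i with
  | zero => simp
  | succ i ih =>
    obtain ⟨M, hM⟩ : ∃ M, N + i = M + 1 := ⟨N + i - 1, by omega⟩
    have h := hp.sum_succ_le hv hB M
    have hNM : (N : ℝ) ≤ (M : ℝ) + 1 := by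
      have : N ≤ M + 1 := by omega
      exact_mod_cast this
    have hN0 : (0 : ℝ) < N := by exact_mod_cast hN
    have hpos : 0 ≤ ∑ k ∈ Finset.range (N + i), p k :=
      Finset.sum_nonneg fun k _ => (hp.pos hv k).le
    rw [← add_assoc, hM]
    rw [hM] at ih hpos
    calc _ ≤ (1 + B / ((M : ℝ) + 1)) * ∑ k ∈ Finset.range (M + 1), p k := h
      _ ≤ (1 + B / N) * ∑ k ∈ Finset.range (M + 1), p k := by gcongr
      _ ≤ (1 + B / N) * ((1 + B / N) ^ i * ∑ k ∈ Finset.range N, p k) := by gcongr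
      _ = _ := by ring

theorem exp_neg_inv_lt_one {N : ℕ} (hN : 1 ≤ N) : Real.exp (-1 / N) < 1 := by
  rw [Real.exp_lt_one_iff]
  have hN0 : (0 : ℝ) < N := by exact_mod_cast hN
  exact div_neg_of_neg_of_pos (by norm_num) hN0

theorem exp_neg_inv_pow (N k : ℕ) :
    Real.exp (-1 / N) ^ k = Real.exp (-((k : ℝ) / N)) := by
  rw [← Real.exp_nat_mul]
  congr 1
  ring

theorem exp_neg_one_le_pow {N : ℕ} (hN : 1 ≤ N) {k : ℕ} (hk : k ≤ N) :
    Real.exp (-1) ≤ Real.exp (-1 / N) ^ k := by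
  rw [exp_neg_inv_pow, Real.exp_le_exp, neg_le_neg_iff, div_le_one (by exact_mod_cast hN)]
  exact_mod_cast hk

/-- The generating function at `e^{-1/N}` is at most of the order of `N p_N`. -/
theorem IsExpCoeff.exists_tsum_le (hp : IsExpCoeff v p) (hθ : 0 < θ) (hvθ : ∀ i, θ ≤ v i)
    (hB : ∀ i, v i ≤ B) :
    ∃ C : ℝ, 0 < C ∧ ∀ N : ℕ, 1 ≤ N → ∑' n, p n * Real.exp (-1 / N) ^ n ≤ C * (N * p N) := by
  have hv : ∀ i, 0 < v i := fun i => hθ.trans_le (hvθ i)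
  have hB0 : 0 < B := (hv 0).trans_le (hB 0)
  -- K is chosen so that the indices from K N on carry at most half of the generating function: with
  -- s = √r, the tail is at most s^{KN} P(s), where s^{KN} = e^{-K/2} and P(s) ≤ 2^B P(r) because (1
  -- - r)/(1 - s) = 1 + s ≤ 2.
  obtain ⟨K, hK⟩ : ∃ K : ℕ, Real.exp (-((K : ℝ) / 2)) * 2 ^ B ≤ 1 / 2 := by
    have h1 : Tendsto (fun K : ℕ => Real.exp (-((K : ℝ) / 2)) * (2 : ℝ) ^ B) atTop
        (𝓝 (0 * (2 : ℝ) ^ B)) := by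
      refine Tendsto.mul_const _ (Real.tendsto_exp_neg_atTop_nhds_zero.comp ?_)
      exact tendsto_natCast_atTop_atTop.atTop_div_const (by norm_num)
    rw [zero_mul] at h1
    exact (h1.eventually (ge_mem_nhds (by norm_num))).exists
  refine ⟨2 * Real.exp (B * K) / θ, by positivity, fun N hN => ?_⟩
  have hN0 : (0 : ℝ) < N := by exact_mod_cast hN
  set r := Real.exp (-1 / N) with hr
  set s := Real.exp (-1 / N / 2) with hs
  have hr1 : r < 1 := exp_neg_inv_lt_one hN
  have hs0 : 0 < s := Real.exp_pos _
  have hsr : s * s = r := by rw [hs, hr, ← Real.exp_add]; congr 1; ring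
  have hs1 : s < 1 := by nlinarith
  have hr0 : 0 < r := Real.exp_pos _
  have hrs : r ≤ s := by nlinarith
  have hPs : ∑' n, p n * s ^ n ≤ (∑' n, p n * r ^ n) * 2 ^ B := by
    refine (hp.tsum_le_of_ge hv hB hr0.le hrs hs1).trans ?_
    refine mul_le_mul_of_nonneg_left ?_ (hp.tsum_nonneg hv hr0.le)
    refine Real.rpow_le_rpow (div_nonneg (by linarith) (by linarith)) ?_ hB0.le
    rw [div_le_iff₀ (by linarith), ← hsr]
    nlinarith
  have sr := hp.summable_real hv hB hr0.le hr1
  have ss := hp.summable_real hv hB hs0.le hs1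
  have hsplit := sr.sum_add_tsum_nat_add (K * N)
  have htail : ∑' n, p (n + K * N) * r ^ (n + K * N) ≤ (∑' n, p n * r ^ n) / 2 := by
    have h1 : ∀ n, p (n + K * N) * r ^ (n + K * N)
        ≤ s ^ (K * N) * (p (n + K * N) * s ^ (n + K * N)) := by
      intro n
      have h2 : s ^ (n + K * N) ≤ s ^ (K * N) :=
        pow_le_pow_of_le_one hs0.le hs1.le (by omega)
      rw [← hsr, mul_pow, mul_left_comm]
      have := (hp.pos hv (n + K * N)).le
      gcongr
    have s3 := (summable_nat_add_iff (K * N)).2 ss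
    have h3 := ((summable_nat_add_iff (K * N)).2 sr).tsum_le_tsum h1 (s3.mul_left _)
    rw [tsum_mul_left] at h3
    have h4 : ∑' n, p (n + K * N) * s ^ (n + K * N) ≤ ∑' n, p n * s ^ n := by
      rw [← ss.sum_add_tsum_nat_add (K * N)]
      have : 0 ≤ ∑ k ∈ Finset.range (K * N), p k * s ^ k :=
        Finset.sum_nonneg fun k _ => mul_nonneg (hp.pos hv k).le (pow_nonneg hs0.le _)
      linarith
    have h5 : s ^ (K * N) = Real.exp (-((K : ℝ) / 2)) := by
      rw [hs, ← Real.exp_nat_mul]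
      congr 1
      push_cast
      field_simp
    calc _ ≤ _ := h3
      _ ≤ s ^ (K * N) * ((∑' n, p n * r ^ n) * 2 ^ B) := by
          have := h4.trans hPs
          gcongr
      _ = (Real.exp (-((K : ℝ) / 2)) * 2 ^ B) * (∑' n, p n * r ^ n) := by rw [h5]; ring
      _ ≤ 1 / 2 * (∑' n, p n * r ^ n) :=
          mul_le_mul_of_nonneg_right hK (hp.tsum_nonneg hv hr0.le)
      _ = _ := by ring
  have hhead : ∑ k ∈ Finset.range (K * N), p k * r ^ k
      ≤ Real.exp (B * K) * ∑ k ∈ Finset.range N, p k := by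
    calc _ ≤ ∑ k ∈ Finset.range (N + K * N), p k := by
          refine (Finset.sum_le_sum fun k _ => ?_).trans (Finset.sum_le_sum_of_subset_of_nonneg
            (Finset.range_mono (Nat.le_add_left _ N)) fun k _ _ => (hp.pos hv k).le)
          exact mul_le_of_le_one_right (hp.pos hv k).le (pow_le_one₀ hr0.le hr1.le)
      _ ≤ (1 + B / N) ^ (K * N) * ∑ k ∈ Finset.range N, p k := hp.sum_range_add_le hv hB hN _
      _ ≤ _ := by
          refine mul_le_mul_of_nonneg_right ?_ (Finset.sum_nonneg fun k _ => (hp.pos hv k).le)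
          have h1 : 1 + B / N ≤ Real.exp (B / N) := by
            rw [add_comm]; exact Real.add_one_le_exp _
          refine (pow_le_pow_left₀ (by positivity) h1 _).trans_eq ?_
          rw [← Real.exp_nat_mul]
          congr 1
          push_cast
          field_simp
  obtain ⟨M, rfl⟩ : ∃ M, N = M + 1 := ⟨N - 1, by omega⟩
  -- The lower bound on `v` in the recursion turns the partial sum below N into a multiple of N p_N.
  have hlow := hp.le_succ_mul hv hvθ M
  have hT : ∑ k ∈ Finset.range (M + 1), p k ≤ ((M + 1 : ℕ) : ℝ) * p (M + 1) / θ := by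
    rw [le_div_iff₀ hθ]; push_cast; linarith
  have hE : Real.exp (B * K) * ∑ k ∈ Finset.range (M + 1), p k
      ≤ Real.exp (B * K) * (((M + 1 : ℕ) : ℝ) * p (M + 1) / θ) := by gcongr
  calc _ ≤ 2 * (Real.exp (B * K) * (((M + 1 : ℕ) : ℝ) * p (M + 1) / θ)) := by linarith
    _ = _ := by ring

/-- The indices `k ≤ N / L` contribute little to the generating function at `e^{-1/N}`. -/
theorem IsExpCoeff.sum_le_rpow_mul_tsum (hp : IsExpCoeff v p) (hθ : 0 < θ) (hvθ : ∀ i, θ ≤ v i)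
    (hB : ∀ i, v i ≤ B) {N L : ℕ} (hL : 1 ≤ L) (hLN : L ≤ N) (s : Finset ℕ)
    (hs : ∀ k ∈ s, k * L ≤ N) :
    ∑ k ∈ s, p k ≤ Real.exp 1 * (Real.exp 1 / L) ^ θ * ∑' n, p n * Real.exp (-1 / N) ^ n := by
  have hN : 1 ≤ N := hL.trans hLN
  have hv : ∀ i, 0 < v i := fun i => hθ.trans_le (hvθ i)
  set r := Real.exp (-1 / N) with hr
  have hr0 : 0 < r := Real.exp_pos _
  have hr1 : r < 1 := exp_neg_inv_lt_one hN
  have hL0 : (0 : ℝ) < L := by exact_mod_cast hL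
  have hrL1 : r ^ L < 1 := pow_lt_one₀ hr0.le hr1 (by omega)
  have hrL : r ^ L ≤ r := pow_le_of_le_one hr0.le hr1.le (by omega)
  -- For k ≤ N/L the weight r^{Lk} is at least 1/e, so these p_k are controlled at the smaller
  -- radius r^L, where the generating function has dropped by a factor of order L^{-θ}.
  have h1 : ∑ k ∈ s, p k ≤ Real.exp 1 * ∑' n, p n * (r ^ L) ^ n := by
    have h2 : ∑ k ∈ s, p k * (r ^ L) ^ k ≤ ∑' n, p n * (r ^ L) ^ n :=
      (hp.summable_real hv hB (pow_nonneg hr0.le _) hrL1).sum_le_tsum s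
        fun k _ => mul_nonneg (hp.pos hv k).le (by positivity)
    refine le_trans ?_ (mul_le_mul_of_nonneg_left h2 (Real.exp_pos 1).le)
    rw [Finset.mul_sum]
    refine Finset.sum_le_sum fun k hk => ?_
    have h3 := exp_neg_one_le_pow hN (k := L * k) (by rw [mul_comm]; exact hs k hk)
    rw [pow_mul] at h3
    have h4 : 1 ≤ Real.exp 1 * (r ^ L) ^ k := by
      have := mul_le_mul_of_nonneg_left h3 (Real.exp_pos 1).le
      rwa [← Real.exp_add, add_neg_cancel, Real.exp_zero] at this
    nlinarith [hp.pos hv k]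
  have h2 := hp.tsum_le_of_le hθ hvθ hB (pow_nonneg hr0.le L) hrL hr1
  have h3 : ((1 - r) / (1 - r ^ L)) ^ θ ≤ (Real.exp 1 / L) ^ θ := by
    refine Real.rpow_le_rpow (div_nonneg (by linarith) (by linarith)) ?_ hθ.le
    rw [div_le_div_iff₀ (by linarith) hL0]
    have h4 : (L : ℝ) * Real.exp (-1) ≤ ∑ i ∈ Finset.range L, r ^ i := by
      have := Finset.card_nsmul_le_sum (Finset.range L) (fun i => r ^ i) (Real.exp (-1))
        fun i hi => exp_neg_one_le_pow hN ((Finset.mem_range.1 hi).le.trans hLN)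
      simpa using this
    have h5 : 1 - r ^ L = (1 - r) * ∑ i ∈ Finset.range L, r ^ i := (mul_neg_geom_sum r L).symm
    rw [h5]
    have h6 : (1 - r) * (L * Real.exp (-1)) ≤ (1 - r) * ∑ i ∈ Finset.range L, r ^ i :=
      mul_le_mul_of_nonneg_left h4 (by linarith)
    have h7 := mul_le_mul_of_nonneg_left h6 (Real.exp_pos 1).le
    have h8 : Real.exp 1 * ((1 - r) * (L * Real.exp (-1))) = (1 - r) * L := by
      rw [Real.exp_neg]; field_simp
    linarith
  calc _ ≤ _ := h1
    _ ≤ Real.exp 1 * ((∑' n, p n * r ^ n) * (Real.exp 1 / L) ^ θ) := by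
        refine mul_le_mul_of_nonneg_left (h2.trans ?_) (Real.exp_pos 1).le
        exact mul_le_mul_of_nonneg_left h3 (hp.tsum_nonneg hv hr0.le)
    _ = _ := by ring

theorem IsExpCoeff.sum_range_le_exp_mul_tsum (hp : IsExpCoeff v p) (hv : ∀ i, 0 < v i)
    (hB : ∀ i, v i ≤ B) {N : ℕ} (hN : 1 ≤ N) :
    ∑ k ∈ Finset.range (N + 1), p k ≤ Real.exp 1 * ∑' n, p n * Real.exp (-1 / N) ^ n := by
  set r := Real.exp (-1 / N) with hr
  have hr0 : 0 < r := Real.exp_pos _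
  have h2 : ∑ k ∈ Finset.range (N + 1), p k * r ^ k ≤ ∑' n, p n * r ^ n :=
    (hp.summable_real hv hB hr0.le (exp_neg_inv_lt_one hN)).sum_le_tsum _
      fun k _ => mul_nonneg (hp.pos hv k).le (by positivity)
  refine le_trans ?_ (mul_le_mul_of_nonneg_left h2 (Real.exp_pos 1).le)
  rw [Finset.mul_sum]
  refine Finset.sum_le_sum fun k hk => ?_
  have h3 := exp_neg_one_le_pow hN (k := k) (by have := Finset.mem_range.1 hk; omega)
  have h4 : 1 ≤ Real.exp 1 * r ^ k := by
    have := mul_le_mul_of_nonneg_left h3 (Real.exp_pos 1).le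
    rwa [← Real.exp_add, add_neg_cancel, Real.exp_zero] at this
  nlinarith [hp.pos hv k]

end Majorant

/-! ### Behaviour of the twist on the circle -/

theorem min_le_three_mul_one_sub_exp_neg {y : ℝ} (hy : 0 ≤ y) :
    min y 2 ≤ 3 * (1 - Real.exp (-y)) := by
  have h1 : Real.exp (-y) ≤ 1 / (1 + y) := by
    rw [Real.exp_neg, inv_eq_one_div]
    exact one_div_le_one_div_of_le (by linarith) (by linarith [Real.add_one_le_exp y])
  have h2 : 1 - 1 / (1 + y) = y / (1 + y) := by field_simp; ring
  have h3 : min y 2 ≤ 3 * (y / (1 + y)) := by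
    rw [← mul_div_assoc, le_div_iff₀ (by linarith)]
    rcases le_total y 2 with h | h
    · rw [min_eq_left h]; nlinarith
    · rw [min_eq_right h]; linarith
  linarith

theorem norm_pow_sub_one_le_min {w : ℂ} (hw : ‖w‖ = 1) (n : ℕ) :
    ‖w ^ n - 1‖ ≤ min (‖w - 1‖ * n) 2 := by
  refine le_min ?_ ?_
  · rw [← mul_geom_sum, norm_mul]
    refine mul_le_mul_of_nonneg_left ?_ (norm_nonneg _)
    refine (norm_sum_le _ _).trans_eq ?_
    simp [norm_pow, hw]
  · refine (norm_sub_le _ _).trans_eq ?_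
    rw [norm_pow, hw]; norm_num

/-- Slow variation of a logarithmic series with coefficients tending to zero. -/
theorem norm_tsum_sub_tsum_le {a : ℕ → ℂ} {B η : ℝ} {J : ℕ} (hB : ∀ i, ‖a i‖ ≤ B) (hη : 0 ≤ η)
    (hJ : ∀ i, J ≤ i → ‖a i‖ ≤ η) {r : ℝ} (hr0 : 0 < r) (hr : r < 1) {w : ℂ} (hw : ‖w‖ = 1) :
    ‖(∑' n : ℕ, a n * (r * w) ^ (n + 1) / ((n : ℂ) + 1))
        - ∑' n : ℕ, a n * (r : ℂ) ^ (n + 1) / ((n : ℂ) + 1)‖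
      ≤ B * J * ‖w - 1‖ + 3 * η * Real.log (1 + ‖w - 1‖ / (1 - r)) := by
  have hrn : ‖(r : ℂ)‖ = r := by rw [Complex.norm_real, Real.norm_of_nonneg hr0.le]
  have s1 := summable_mul_pow_succ_div hB (z := r * w) (by rw [norm_mul, hrn, hw, mul_one]; exact hr)
  have s2 := summable_mul_pow_succ_div hB (z := (r : ℂ)) (by rw [hrn]; exact hr)
  set x := ‖w - 1‖ with hx
  have hx0 : 0 ≤ x := norm_nonneg _
  set q := r * Real.exp (-x) with hq
  have hq0 : 0 < q := mul_pos hr0 (Real.exp_pos _)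
  have he1 : Real.exp (-x) ≤ 1 := Real.exp_le_one_iff.2 (by linarith)
  have hqr : q ≤ r := mul_le_of_le_one_right hr0.le he1
  have s3 : HasSum (fun n : ℕ => r ^ (n + 1) / ((n : ℝ) + 1)) (-Real.log (1 - r)) :=
    Real.hasSum_pow_div_log_of_abs_lt_one (by rwa [abs_of_pos hr0])
  have s4 : HasSum (fun n : ℕ => q ^ (n + 1) / ((n : ℝ) + 1)) (-Real.log (1 - q)) :=
    Real.hasSum_pow_div_log_of_abs_lt_one (by rw [abs_of_pos hq0]; linarith)
  have s5 := (s3.sub s4).mul_left (3 * η)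
  have s6 : HasSum (fun n : ℕ => if n ∈ Finset.range J then B * x else 0)
      (∑ n ∈ Finset.range J, if n ∈ Finset.range J then B * x else 0) :=
    hasSum_sum_of_ne_finset_zero fun n hn => if_neg hn
  have hterm : ∀ n : ℕ, ‖a n * (r * w) ^ (n + 1) / ((n : ℂ) + 1)
      - a n * (r : ℂ) ^ (n + 1) / ((n : ℂ) + 1)‖
      ≤ (if n ∈ Finset.range J then B * x else 0)
        + 3 * η * (r ^ (n + 1) / ((n : ℝ) + 1) - q ^ (n + 1) / ((n : ℝ) + 1)) := by
    intro n
    have h1 : ‖(n : ℂ) + 1‖ = (n : ℝ) + 1 := by exact_mod_cast Complex.norm_natCast (n + 1)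
    have hn0 : (0 : ℝ) < (n : ℝ) + 1 := by positivity
    have h2 : ‖a n * (r * w) ^ (n + 1) / ((n : ℂ) + 1) - a n * (r : ℂ) ^ (n + 1) / ((n : ℂ) + 1)‖
        = ‖a n‖ * (r ^ (n + 1) * ‖w ^ (n + 1) - 1‖ / ((n : ℝ) + 1)) := by
      have : a n * (r * w) ^ (n + 1) / ((n : ℂ) + 1) - a n * (r : ℂ) ^ (n + 1) / ((n : ℂ) + 1)
          = a n * ((r : ℂ) ^ (n + 1) * (w ^ (n + 1) - 1) / ((n : ℂ) + 1)) := by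
        rw [mul_pow]; ring
      rw [this, norm_mul, norm_div, norm_mul, norm_pow, hrn, h1]
    have h3 := norm_pow_sub_one_le_min hw (n + 1)
    have h4 : q ^ (n + 1) = r ^ (n + 1) * Real.exp (-(x * (n + 1 : ℕ))) := by
      rw [hq, mul_pow, ← Real.exp_nat_mul]
      congr 2
      push_cast; ring
    have h5 : r ^ (n + 1) / ((n : ℝ) + 1) - q ^ (n + 1) / ((n : ℝ) + 1)
        = r ^ (n + 1) * (1 - Real.exp (-(x * (n + 1 : ℕ)))) / ((n : ℝ) + 1) := by
      rw [h4]; ring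
    have h6 := min_le_three_mul_one_sub_exp_neg (y := x * (n + 1 : ℕ)) (by positivity)
    have h7 : 0 ≤ 1 - Real.exp (-(x * (n + 1 : ℕ))) := by
      have := Real.exp_le_one_iff.2 (show -(x * (n + 1 : ℕ)) ≤ 0 by
        rw [neg_nonpos]; positivity)
      linarith
    rw [h2, h5]
    split_ifs with hn
    · have h8 : r ^ (n + 1) * ‖w ^ (n + 1) - 1‖ / ((n : ℝ) + 1) ≤ x := by
        rw [div_le_iff₀ hn0]
        have h9 : ‖w ^ (n + 1) - 1‖ ≤ x * ((n : ℝ) + 1) := by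
          have := h3.trans (min_le_left _ _)
          push_cast at this
          exact this
        exact (mul_le_of_le_one_left (norm_nonneg _) (pow_le_one₀ hr0.le hr.le)).trans h9
      have h10 : ‖a n‖ * (r ^ (n + 1) * ‖w ^ (n + 1) - 1‖ / ((n : ℝ) + 1)) ≤ B * x :=
        mul_le_mul (hB n) h8 (by positivity) ((norm_nonneg _).trans (hB n))
      have h11 : 0 ≤ 3 * η * (r ^ (n + 1) * (1 - Real.exp (-(x * (n + 1 : ℕ)))) / ((n : ℝ) + 1)) :=
        by positivity
      linarith
    · have h8 : ‖a n‖ ≤ η := hJ n (by simpa using hn)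
      have h9 := h3.trans h6
      rw [zero_add]
      calc _ ≤ η * (r ^ (n + 1) * (3 * (1 - Real.exp (-(x * (n + 1 : ℕ))))) / ((n : ℝ) + 1)) := by
            gcongr
        _ = _ := by ring
  rw [← s1.tsum_sub s2]
  have h := tsum_of_norm_bounded (s6.add s5) hterm
  refine h.trans ?_
  have h1 : (∑ n ∈ Finset.range J, if n ∈ Finset.range J then B * x else 0) = B * J * x := by
    rw [Finset.sum_congr rfl fun n hn => if_pos hn]
    simp; ring
  rw [h1]
  have h2 : -Real.log (1 - r) - -Real.log (1 - q) ≤ Real.log (1 + x / (1 - r)) := by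
    have h3 : -Real.log (1 - r) - -Real.log (1 - q) = Real.log ((1 - q) / (1 - r)) := by
      rw [Real.log_div (by linarith) (by linarith)]; ring
    rw [h3]
    refine Real.log_le_log (div_pos (by linarith) (by linarith)) ?_
    have h4 : 1 - x ≤ Real.exp (-x) := by linarith [Real.add_one_le_exp (-x)]
    rw [div_le_iff₀ (by linarith), add_mul, div_mul_cancel₀ _ (by linarith)]
    nlinarith
  have := mul_le_mul_of_nonneg_left h2 (show 0 ≤ 3 * η by positivity)
  linarith

/-- Both 1 - r and, for r bounded away from 0, ‖w - 1‖ are O(‖1 - rw‖), hence so is their sum. -/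
theorem one_sub_div_norm_one_sub_mul_le {w : ℂ} (hw : ‖w‖ = 1) {r : ℝ} (hr0 : 1 / 3 ≤ r)
    (hr : r < 1) : (1 - r) / ‖1 - r * w‖ ≤ 9 * (1 + ‖w - 1‖ / (1 - r))⁻¹ := by
  have hrn : ‖(r : ℂ)‖ = r := by rw [Complex.norm_real, Real.norm_of_nonneg (by linarith)]
  have h0 : 0 < 1 - r := by linarith
  have h1 : 1 - r ≤ ‖1 - r * w‖ := by
    have := norm_sub_norm_le (1 : ℂ) (r * w)
    rwa [norm_one, norm_mul, hrn, hw, mul_one] at this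
  have h2 : r * ‖w - 1‖ ≤ ‖1 - r * w‖ + (1 - r) := by
    have h3 : (r : ℂ) * (w - 1) = ((1 - r : ℝ) : ℂ) - (1 - r * w) := by push_cast; ring
    have h4 := norm_sub_le ((1 - r : ℝ) : ℂ) (1 - r * w)
    rw [← h3, norm_mul, hrn, Complex.norm_real, Real.norm_of_nonneg h0.le] at h4
    linarith
  have h3 : 0 ≤ ‖w - 1‖ := norm_nonneg _
  have h5 : (1 + ‖w - 1‖ / (1 - r)) = ((1 - r) + ‖w - 1‖) / (1 - r) := by field_simp
  rw [h5, inv_div, ← mul_div_assoc, div_le_div_iff₀ (by linarith) (by linarith)]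
  have h6 : (1 - r) + ‖w - 1‖ ≤ 9 * ‖1 - r * w‖ := by nlinarith
  nlinarith

theorem norm_exp_sub_one_le_mul_exp (z : ℂ) : ‖Complex.exp z - 1‖ ≤ ‖z‖ * Real.exp ‖z‖ := by
  have := Complex.norm_exp_sub_sum_le_norm_mul_exp z 1
  simpa using this

/-- On the circle of radius `r` the generating function, twisted by the exponential of a
logarithmic series with coefficients tending to zero, is uniformly close to its multiple by the
value of the twist at `r`. -/
theorem IsExpCoeff.eventually_norm_sub_le {v p : ℕ → ℝ} {θ B : ℝ} (hp : IsExpCoeff v p)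
    (hθ : 0 < θ) (hθ1 : θ ≤ 1) (hvθ : ∀ i, θ ≤ v i) (hB : ∀ i, v i ≤ B) {a : ℕ → ℂ} {D : ℝ}
    (hD : ∀ i, ‖a i‖ ≤ D) (ha : Tendsto a atTop (𝓝 0)) {ε : ℝ} (hε : 0 < ε) :
    ∀ᶠ r : ℝ in 𝓝[<] 1, ∀ w : ℂ, ‖w‖ = 1 →
      ‖∑' n, (p n : ℂ) * (r * w) ^ n‖ *
        ‖Complex.exp ((∑' n : ℕ, a n * (r * w) ^ (n + 1) / ((n : ℂ) + 1))
          - ∑' n : ℕ, a n * (r : ℂ) ^ (n + 1) / ((n : ℂ) + 1)) - 1‖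
      ≤ ε * ∑' n, p n * r ^ n := by
  have hv : ∀ i, 0 < v i := fun i => hθ.trans_le (hvθ i)
  have hD0 : 0 ≤ D := (norm_nonneg _).trans (hD 0)
  have hsmall : ∀ η : ℝ, 0 < η → ∃ J : ℕ, ∀ i, J ≤ i → ‖a i‖ ≤ η := by
    intro η hη
    have h := ha.norm
    rw [norm_zero] at h
    exact eventually_atTop.1 (h.eventually (ge_mem_nhds hη))
  -- With η = θ/6 the logarithmic term is (θ/2) log y, so exp ‖Δ‖ costs only half of the decay
  -- y^{-θ}. The other half absorbs ‖Δ‖ itself, which is bounded with the finer threshold J.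
  obtain ⟨J₀, hJ₀⟩ := hsmall (θ / 6) (by positivity)
  set K := 9 * Real.exp (D * J₀ * 2) with hK
  have hK0 : 0 < K := by positivity
  obtain ⟨J, hJ⟩ := hsmall (ε * θ / (12 * K)) (by positivity)
  have hlim : Tendsto (fun r : ℝ => K * (D * J * (2 * (1 - r) ^ (θ / 2)))) (𝓝[<] 1) (𝓝 0) := by
    have h1 : ContinuousAt (fun r : ℝ => K * (D * J * (2 * (1 - r) ^ (θ / 2)))) 1 := by
      have : ContinuousAt (fun r : ℝ => (1 - r) ^ (θ / 2)) 1 :=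
        ContinuousAt.rpow_const (by fun_prop) (Or.inr (by positivity))
      fun_prop
    have h2 := h1.tendsto.mono_left (nhdsWithin_le_nhds (s := Set.Iio (1 : ℝ)))
    simpa [Real.zero_rpow (show θ / 2 ≠ 0 by positivity)] using h2
  filter_upwards [hlim.eventually (ge_mem_nhds (half_pos hε)), self_mem_nhdsWithin,
    mem_nhdsWithin_of_mem_nhds (Ici_mem_nhds (show (1 / 3 : ℝ) < 1 by norm_num))]
    with r hlimr hr hr3 w hw
  have hr : r < 1 := hr
  have hr3 : 1 / 3 ≤ r := hr3
  have hr0 : 0 < r := by linarith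
  have hrn : ‖(r : ℂ)‖ = r := by rw [Complex.norm_real, Real.norm_of_nonneg hr0.le]
  set x := ‖w - 1‖ with hx
  have hx0 : 0 ≤ x := norm_nonneg _
  have hx2 : x ≤ 2 := by
    refine (norm_sub_le _ _).trans_eq ?_
    rw [hw, norm_one]; norm_num
  set y := 1 + x / (1 - r) with hy
  have hy1 : 1 ≤ y := by
    have : 0 ≤ x / (1 - r) := div_nonneg hx0 (by linarith)
    linarith
  have hy0 : 0 < y := by linarith
  set Δ := (∑' n : ℕ, a n * (r * w) ^ (n + 1) / ((n : ℂ) + 1))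
          - ∑' n : ℕ, a n * (r : ℂ) ^ (n + 1) / ((n : ℂ) + 1) with hΔ
  set Q := ∑' n, p n * r ^ n with hQ
  have hQ0 : 0 ≤ Q := hp.tsum_nonneg hv hr0.le
  have hP : ‖∑' n, (p n : ℂ) * (r * w) ^ n‖ ≤ Q * (9 * y ^ (-θ)) := by
    refine (hp.norm_tsum_le hθ hvθ hB (z := r * w) (r := r)
      (by rw [norm_mul, hrn, hw, mul_one]) hr).trans ?_
    refine mul_le_mul_of_nonneg_left ?_ hQ0
    have h1 := one_sub_div_norm_one_sub_mul_le hw hr3 hr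
    have h2 := Real.rpow_le_rpow (div_nonneg (by linarith) (norm_nonneg _)) h1 hθ.le
    refine h2.trans ?_
    rw [Real.mul_rpow (by norm_num) (by positivity), Real.inv_rpow hy0.le, Real.rpow_neg hy0.le]
    refine mul_le_mul_of_nonneg_right ?_ (by positivity)
    calc (9 : ℝ) ^ θ ≤ 9 ^ (1 : ℝ) := Real.rpow_le_rpow_of_exponent_le (by norm_num) hθ1
      _ = 9 := Real.rpow_one 9
  have hΔ0 : Real.exp ‖Δ‖ ≤ Real.exp (D * J₀ * 2) * y ^ (θ / 2) := by
    rw [Real.rpow_def_of_pos hy0, ← Real.exp_add, Real.exp_le_exp]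
    have h1 := norm_tsum_sub_tsum_le hD (by positivity) hJ₀ hr0 hr hw
    have h2 : D * J₀ * x ≤ D * J₀ * 2 := by gcongr
    refine h1.trans ?_
    rw [← hx, ← hy]
    nlinarith
  have hΔ1 : y ^ (-(θ / 2)) * ‖Δ‖
      ≤ D * J * (2 * (1 - r) ^ (θ / 2)) + 3 * (ε * θ / (12 * K)) * (2 / θ) := by
    have h1 := norm_tsum_sub_tsum_le hD (by positivity) hJ hr0 hr hw
    have hyp : 0 < y ^ (θ / 2) := Real.rpow_pos_of_pos hy0 _
    rw [Real.rpow_neg hy0.le, inv_mul_le_iff₀ hyp]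
    refine h1.trans ?_
    rw [← hx, ← hy]
    -- Since (1 - r) y = 1 - r + x ≥ x/2 and x/2 ≤ 1, the contribution of the first J terms gains a
    -- factor vanishing as r → 1.
    have h2 : x ≤ 2 * ((1 - r) ^ (θ / 2) * y ^ (θ / 2)) := by
      have h3 : x / 2 ≤ (x / 2) ^ (θ / 2) := by
        rcases hx0.eq_or_lt with h | h
        · rw [← h]; simp [Real.zero_rpow (show θ / 2 ≠ 0 by positivity)]
        · have := Real.rpow_le_rpow_of_exponent_ge (x := x / 2) (by linarith) (by linarith)
            (show θ / 2 ≤ 1 by linarith)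
          rwa [Real.rpow_one] at this
      have h4 : (x / 2) ^ (θ / 2) ≤ ((1 - r) * y) ^ (θ / 2) := by
        refine Real.rpow_le_rpow (by linarith) ?_ (by positivity)
        have h5 : (1 - r) * y = (1 - r) + x := by
          have : (1 : ℝ) - r ≠ 0 := by linarith
          rw [hy]; field_simp
        rw [h5]; linarith
      rw [Real.mul_rpow (by linarith) hy0.le] at h4
      linarith
    have h3 : Real.log y ≤ y ^ (θ / 2) * (2 / θ) := by
      have := Real.log_le_rpow_div hy0.le (show 0 < θ / 2 by positivity)
      refine this.trans_eq ?_
      field_simp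
    have h4 : D * J * x ≤ D * J * (2 * ((1 - r) ^ (θ / 2) * y ^ (θ / 2))) := by gcongr
    have h5 : 3 * (ε * θ / (12 * K)) * Real.log y
        ≤ 3 * (ε * θ / (12 * K)) * (y ^ (θ / 2) * (2 / θ)) := by gcongr
    refine (add_le_add h4 h5).trans_eq ?_
    ring
  have hsplit : y ^ (-θ) = y ^ (-(θ / 2)) * y ^ (-(θ / 2)) := by
    rw [← Real.rpow_add hy0]; congr 1; ring
  have hcancel : y ^ (-(θ / 2)) * y ^ (θ / 2) = 1 := by
    rw [← Real.rpow_add hy0]; simp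
  calc ‖∑' n, (p n : ℂ) * (r * w) ^ n‖ * ‖Complex.exp Δ - 1‖
      ≤ (Q * (9 * y ^ (-θ))) * (‖Δ‖ * (Real.exp (D * J₀ * 2) * y ^ (θ / 2))) := by
        refine mul_le_mul hP ((norm_exp_sub_one_le_mul_exp _).trans ?_) (norm_nonneg _)
          (mul_nonneg hQ0 (by positivity))
        gcongr
    _ = (y ^ (-(θ / 2)) * y ^ (θ / 2)) * K * (y ^ (-(θ / 2)) * ‖Δ‖) * Q := by
        rw [hsplit, hK]; ring
    _ ≤ 1 * K * (D * J * (2 * (1 - r) ^ (θ / 2)) + 3 * (ε * θ / (12 * K)) * (2 / θ)) * Q := by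
        rw [hcancel]
        gcongr
    _ ≤ ε * Q := by
        refine mul_le_mul_of_nonneg_right ?_ hQ0
        have h1 : K * (3 * (ε * θ / (12 * K)) * (2 / θ)) = ε / 2 := by field_simp; norm_num
        rw [one_mul, mul_add, h1]
        linarith

/-! ### Estimates at the radius e^{-1/N} -/

theorem one_div_one_sub_exp_neg_inv_le {N : ℕ} (hN : 1 ≤ N) :
    (1 - Real.exp (-1 / N))⁻¹ ≤ 2 * N := by
  have hN1 : (1 : ℝ) ≤ N := by exact_mod_cast hN
  have h1 : Real.exp (-1 / N) ≤ 1 / (1 + 1 / N) := by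
    rw [neg_div, Real.exp_neg, inv_eq_one_div]
    exact one_div_le_one_div_of_le (by positivity) (by linarith [Real.add_one_le_exp (1 / (N : ℝ))])
  have h2 : 1 / (1 + 1 / (N : ℝ)) = 1 - 1 / (N + 1) := by field_simp; ring
  have h3 : 1 / (2 * (N : ℝ)) ≤ 1 / (N + 1) :=
    one_div_le_one_div_of_le (by positivity) (by linarith)
  rw [inv_le_comm₀ (by linarith [exp_neg_inv_lt_one hN]) (by positivity), inv_eq_one_div]
  linarith

/-- The first J terms contribute a constant, the others a geometric series. For coefficients tending
to 0 the sum is thus o(N); with J = 0 it is O(N) for bounded ones. -/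
theorem tsum_norm_sq_mul_pow_le {a : ℕ → ℂ} {D η : ℝ} {J N : ℕ} (hN : 1 ≤ N)
    (hD : ∀ i, ‖a i‖ ≤ D) (hJ : ∀ i, J ≤ i → ‖a i‖ ≤ η) :
    ∑' i, ‖a i * ((Real.exp (-1 / N) : ℝ) : ℂ) ^ i‖ ^ 2 ≤ J * D ^ 2 + η ^ 2 * (2 * N) := by
  set r := Real.exp (-1 / N) with hr
  have hr0 : 0 < r := Real.exp_pos _
  have hr1 : r < 1 := exp_neg_inv_lt_one hN
  have hs := (hasSum_geometric_of_lt_one hr0.le hr1).mul_left (η ^ 2)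
  have hf : HasSum (fun n : ℕ => if n ∈ Finset.range J then D ^ 2 else 0)
      (∑ n ∈ Finset.range J, if n ∈ Finset.range J then D ^ 2 else 0) :=
    hasSum_sum_of_ne_finset_zero fun n hn => if_neg hn
  have hterm : ∀ i, ‖a i * (r : ℂ) ^ i‖ ^ 2
      ≤ (if i ∈ Finset.range J then D ^ 2 else 0) + η ^ 2 * r ^ i := by
    intro i
    have h1 : (r ^ i) ^ 2 ≤ r ^ i := by
      rw [sq]; exact mul_le_of_le_one_left (by positivity) (pow_le_one₀ hr0.le hr1.le)
    rw [norm_mul_pow_eq hr0.le, mul_pow]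
    split_ifs with hi
    · have h2 : ‖a i‖ ^ 2 ≤ D ^ 2 := pow_le_pow_left₀ (norm_nonneg _) (hD i) 2
      have h3 : ‖a i‖ ^ 2 * (r ^ i) ^ 2 ≤ ‖a i‖ ^ 2 * 1 :=
        mul_le_mul_of_nonneg_left (h1.trans (pow_le_one₀ hr0.le hr1.le)) (by positivity)
      have h4 : 0 ≤ η ^ 2 * r ^ i := by positivity
      linarith
    · have h2 : ‖a i‖ ^ 2 ≤ η ^ 2 := pow_le_pow_left₀ (norm_nonneg _) (hJ i (by simpa using hi)) 2
      rw [zero_add]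
      gcongr
  refine (Summable.tsum_le_tsum hterm ((hf.add hs).summable.of_nonneg_of_le
    (fun _ => by positivity) hterm) (hf.add hs).summable).trans ?_
  rw [(hf.add hs).tsum_eq]
  have h1 : (∑ n ∈ Finset.range J, if n ∈ Finset.range J then D ^ 2 else 0) = J * D ^ 2 := by
    rw [Finset.sum_congr rfl fun n hn => if_pos hn]
    simp
  rw [h1]
  have := one_div_one_sub_exp_neg_inv_le hN
  gcongr

/-- In the upper half of the range the division by k in the recursion is a division by N up to a
factor 2. -/
theorem IsExpCoeff.le_of_le_mul {v p : ℕ → ℝ} {B : ℝ} (hp : IsExpCoeff v p) (hv : ∀ i, 0 < v i)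
    (hB : ∀ i, v i ≤ B) {N k : ℕ} (hN : 1 ≤ N) (hk : k ≤ N) (hk2 : N ≤ k * 2) :
    p k ≤ 2 * B * Real.exp 1 / N * ∑' n, p n * Real.exp (-1 / N) ^ n := by
  have hB0 : 0 < B := (hv 0).trans_le (hB 0)
  have hN0 : (0 : ℝ) < N := by exact_mod_cast hN
  obtain ⟨j, rfl⟩ : ∃ j, k = j + 1 := ⟨k - 1, by omega⟩
  have h1 := hp.succ_mul_le hv hB j
  have h2 := hp.sum_range_le_exp_mul_tsum hv hB hN
  have h3 : ∑ i ∈ Finset.range (j + 1), p i ≤ ∑ i ∈ Finset.range (N + 1), p i :=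
    Finset.sum_le_sum_of_subset_of_nonneg (Finset.range_mono (by omega))
      fun i _ _ => (hp.pos hv i).le
  have h4 : (N : ℝ) ≤ ((j : ℝ) + 1) * 2 := by exact_mod_cast hk2
  have h5 : B * ∑ i ∈ Finset.range (j + 1), p i
      ≤ B * (Real.exp 1 * ∑' n, p n * Real.exp (-1 / N) ^ n) := by
    have := h3.trans h2
    gcongr
  rw [div_mul_eq_mul_div, le_div_iff₀ hN0]
  nlinarith [hp.pos hv (j + 1)]

/-! ### Mean square comparison of the two sequences -/

section Twist

variable {v p : ℕ → ℝ} {φ m : ℕ → ℂ} {θ B : ℝ}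

/-- The exponential of the logarithmic series with coefficients `v i * (φ i - 1)`. -/
noncomputable def twist (v : ℕ → ℝ) (φ : ℕ → ℂ) (z : ℂ) : ℂ :=
  ∑' n : ℕ, ((v n : ℂ) * (φ n - 1)) * z ^ (n + 1) / ((n : ℂ) + 1)

theorem norm_mul_sub_one_le (hv : ∀ i, 0 < v i) (hB : ∀ i, v i ≤ B) (hφ : ∀ i, ‖φ i‖ ≤ 1)
    (i : ℕ) : ‖(v i : ℂ) * (φ i - 1)‖ ≤ 2 * B := by
  rw [norm_mul, Complex.norm_real, Real.norm_of_nonneg (hv i).le, mul_comm]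
  have h1 : ‖φ i - 1‖ ≤ 2 := by
    refine (norm_sub_le _ _).trans ?_
    rw [norm_one]; linarith [hφ i]
  exact mul_le_mul h1 (hB i) (hv i).le (by norm_num)

theorem norm_ofReal_mul_le (hv : ∀ i, 0 < v i) (hφ : ∀ i, ‖φ i‖ ≤ 1) (i : ℕ) :
    ‖(v i : ℂ) * φ i‖ ≤ v i := by
  rw [norm_mul, Complex.norm_real, Real.norm_of_nonneg (hv i).le]
  exact mul_le_of_le_one_right (hv i).le (hφ i)

/-- Re φ ≤ 1 makes the real part of each term of the exponent nonpositive. -/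
theorem norm_exp_twist_le_one (hv : ∀ i, 0 < v i) (hB : ∀ i, v i ≤ B) (hφ : ∀ i, ‖φ i‖ ≤ 1)
    {r : ℝ} (hr0 : 0 ≤ r) (hr : r < 1) : ‖Complex.exp (twist v φ r)‖ ≤ 1 := by
  rw [Complex.norm_exp, Real.exp_le_one_iff, twist, Complex.re_tsum
    (summable_mul_pow_succ_div (norm_mul_sub_one_le hv hB hφ) (by simpa [abs_of_nonneg hr0] using hr))]
  refine tsum_nonpos fun n => ?_
  have h : ((v n : ℂ) * (φ n - 1)) * (r : ℂ) ^ (n + 1) / ((n : ℂ) + 1)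
      = ((v n * r ^ (n + 1) / ((n : ℝ) + 1) : ℝ) : ℂ) * (φ n - 1) := by
    push_cast; ring
  rw [h, Complex.re_ofReal_mul]
  refine mul_nonpos_of_nonneg_of_nonpos ?_ ?_
  · have := (hv n).le
    positivity
  · rw [Complex.sub_re, Complex.one_re]
    linarith [(Complex.re_le_norm (φ n)).trans (hφ n)]

theorem IsExpCoeff.tsum_eq_mul_exp_twist (hp : IsExpCoeff v p)
    (hm : IsExpCoeff (fun i => (v i : ℂ) * φ i) m) (hv : ∀ i, 0 < v i) (hB : ∀ i, v i ≤ B)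
    (hφ : ∀ i, ‖φ i‖ ≤ 1) {z : ℂ} (hz : ‖z‖ < 1) :
    ∑' n, m n * z ^ n = (∑' n, (p n : ℂ) * z ^ n) * Complex.exp (twist v φ z) := by
  have hvn : ∀ i, ‖(v i : ℂ)‖ ≤ v i := fun i => by
    rw [Complex.norm_real, Real.norm_of_nonneg (hv i).le]
  have hb : ∀ i, ‖(v i : ℂ)‖ ≤ B := fun i => (hvn i).trans (hB i)
  rw [hm.tsum_eq_exp (fun i => (norm_ofReal_mul_le hv hφ i).trans (hB i))
      (fun r h0 h1 => hm.summable hp hv hB (norm_ofReal_mul_le hv hφ) h0 h1) hz,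
    hp.ofReal.tsum_eq_exp hb (fun r h0 h1 => hp.ofReal.summable hp hv hB hvn h0 h1) hz,
    ← Complex.exp_add, twist, ← (summable_mul_pow_succ_div hb hz).tsum_add
      (summable_mul_pow_succ_div (norm_mul_sub_one_le hv hB hφ) hz)]
  congr 1
  refine tsum_congr fun n => ?_
  ring

/-- Split v φ = v + v (φ - 1) in the recursion for `m`: one convolution contains the unknown
differences, the other has a kernel that is small when φ is near 1. -/
theorem IsExpCoeff.succ_mul_sub (hp : IsExpCoeff v p)
    (hm : IsExpCoeff (fun i => (v i : ℂ) * φ i) m) (A : ℂ) (n : ℕ) :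
    ((n : ℂ) + 1) * (m (n + 1) - A * p (n + 1))
      = (∑ x ∈ Finset.HasAntidiagonal.antidiagonal n, (v x.1 : ℂ) * (m x.2 - A * p x.2))
        + ∑ x ∈ Finset.HasAntidiagonal.antidiagonal n, ((v x.1 : ℂ) * (φ x.1 - 1)) * m x.2 := by
  have h1 := hm.2 n
  have h2 := hp.ofReal.2 n
  rw [mul_sub, h1, mul_left_comm, h2, Finset.mul_sum, ← Finset.sum_sub_distrib,
    ← Finset.sum_add_distrib]
  exact Finset.sum_congr rfl fun x _ => by ring

theorem sum_norm_sq_antidiagonal_mul_pow_le {a b : ℕ → ℂ} {r C : ℝ} (hr0 : 0 ≤ r)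
    (ha : Summable fun n => ‖a n‖ * r ^ n) (hb : Summable fun n => ‖b n‖ * r ^ n)
    (hC : ∀ w : ℂ, ‖w‖ = 1 → ‖∑' n, b n * (r * w) ^ n‖ ≤ C) (s : Finset ℕ) :
    ∑ n ∈ s, (‖∑ x ∈ Finset.HasAntidiagonal.antidiagonal n, a x.1 * b x.2‖ * r ^ n) ^ 2
      ≤ C ^ 2 * ∑' n, ‖a n * (r : ℂ) ^ n‖ ^ 2 := by
  have h := sum_norm_sq_antidiagonal_le (a := fun n => a n * (r : ℂ) ^ n)
    (b := fun n => b n * (r : ℂ) ^ n) (B := C) (by simpa only [norm_mul_pow_eq hr0] using ha)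
    (by simpa only [norm_mul_pow_eq hr0] using hb)
    (fun w hw => by simpa only [mul_pow, mul_assoc] using hC w hw) s
  refine le_of_eq_of_le (Finset.sum_congr rfl fun n _ => ?_) h
  rw [sum_antidiagonal_mul_pow]
  congr 1
  exact (norm_mul_pow_eq (c := fun n => ∑ x ∈ Finset.HasAntidiagonal.antidiagonal n,
    a x.1 * b x.2) hr0 n).symm

/-- Mean square bound for the differences of the two coefficient sequences. -/
theorem IsExpCoeff.sum_norm_le_of_norm_sub_le (hp : IsExpCoeff v p)
    (hm : IsExpCoeff (fun i => (v i : ℂ) * φ i) m) (hv : ∀ i, 0 < v i) (hB : ∀ i, v i ≤ B)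
    (hφ : ∀ i, ‖φ i‖ ≤ 1) {N J : ℕ} (hN : 1 ≤ N) {ε : ℝ} (hε : 0 < ε)
    (hJ : ∀ i, J ≤ i → ‖(v i : ℂ) * (φ i - 1)‖ ≤ ε) (hJN : J * (2 * B) ^ 2 ≤ ε ^ 2 * N) {A : ℂ}
    {q : ℝ} (hq : q = ∑' n, p n * Real.exp (-1 / N) ^ n)
    (hA : ∀ w : ℂ, ‖w‖ = 1 →
      ‖∑' n, (m n - A * p n) * (((Real.exp (-1 / N) : ℝ) : ℂ) * w) ^ n‖ ≤ ε * q) :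
    ∑ k ∈ Finset.range N, ((k : ℝ) + 1) * ‖m (k + 1) - A * p (k + 1)‖
      ≤ N * (ε * (6 * B + 8) * q) := by
  have hB0 : 0 < B := (hv 0).trans_le (hB 0)
  set r := Real.exp (-1 / N) with hr
  have hr0 : 0 < r := Real.exp_pos _
  have hr1 : r < 1 := exp_neg_inv_lt_one hN
  have hq0 : 0 ≤ q := hq ▸ hp.tsum_nonneg hv hr0.le
  have hvn : ∀ i, ‖(v i : ℂ)‖ ≤ v i := fun i => by
    rw [Complex.norm_real, Real.norm_of_nonneg (hv i).le]
  have hb : ∀ i, ‖(v i : ℂ)‖ ≤ B := fun i => (hvn i).trans (hB i)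
  have hmp := hm.norm_le hp (norm_ofReal_mul_le hv hφ)
  have sm := hm.summable hp hv hB (norm_ofReal_mul_le hv hφ) hr0.le hr1
  have sp := hp.ofReal.summable hp hv hB hvn hr0.le hr1
  have sw : Summable fun n => ‖m n - A * p n‖ * r ^ n := by
    refine (sm.add (sp.mul_left ‖A‖)).of_nonneg_of_le (fun n => by positivity) fun n => ?_
    rw [← mul_assoc, ← add_mul, ← norm_mul]
    exact mul_le_mul_of_nonneg_right (norm_sub_le _ _) (by positivity)
  have hM : ∀ w : ℂ, ‖w‖ = 1 → ‖∑' n, m n * ((r : ℂ) * w) ^ n‖ ≤ q := by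
    intro w hw
    rw [hq]
    refine tsum_of_norm_bounded (hp.summable_real hv hB hr0.le hr1).hasSum fun n => ?_
    rw [norm_mul, norm_pow, norm_mul, hw, mul_one, Complex.norm_real, Real.norm_of_nonneg hr0.le]
    exact mul_le_mul_of_nonneg_right (hmp n) (by positivity)
  have h1 := sum_norm_sq_antidiagonal_mul_pow_le hr0.le
    (summable_norm_mul_pow_of_bounded hb hr0.le hr1) sw hA (Finset.range N)
  have h2 := sum_norm_sq_antidiagonal_mul_pow_le hr0.le
    (summable_norm_mul_pow_of_bounded (norm_mul_sub_one_le hv hB hφ) hr0.le hr1) sm hM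
    (Finset.range N)
  have h3 := tsum_norm_sq_mul_pow_le (J := 0) hN hb fun i _ => hb i
  have h4 := tsum_norm_sq_mul_pow_le hN (norm_mul_sub_one_le hv hB hφ) hJ
  rw [← hr] at h3 h4
  have h1' := h1.trans (mul_le_mul_of_nonneg_left h3 (sq_nonneg _))
  have h2' := h2.trans (mul_le_mul_of_nonneg_left h4 (sq_nonneg _))
  -- 18 = 2 · 9: the 2 from ‖X + Y‖² ≤ 2(‖X‖² + ‖Y‖²), the 9 from r^k ≥ 1/e ≥ 1/3.
  have hterm : ∀ k ∈ Finset.range N, (((k : ℝ) + 1) * ‖m (k + 1) - A * p (k + 1)‖) ^ 2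
      ≤ 18 * ((‖∑ x ∈ Finset.HasAntidiagonal.antidiagonal k,
          (v x.1 : ℂ) * (m x.2 - A * p x.2)‖ * r ^ k) ^ 2
        + (‖∑ x ∈ Finset.HasAntidiagonal.antidiagonal k,
          ((v x.1 : ℂ) * (φ x.1 - 1)) * m x.2‖ * r ^ k) ^ 2) := by
    intro k hk
    have hn : ‖(k : ℂ) + 1‖ = (k : ℝ) + 1 := by exact_mod_cast Complex.norm_natCast (k + 1)
    rw [← hn, ← norm_mul, hp.succ_mul_sub hm]
    set X := ∑ x ∈ Finset.HasAntidiagonal.antidiagonal k, (v x.1 : ℂ) * (m x.2 - A * p x.2)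
    set Y := ∑ x ∈ Finset.HasAntidiagonal.antidiagonal k, ((v x.1 : ℂ) * (φ x.1 - 1)) * m x.2
    have h5 : 1 / 3 ≤ r ^ k := by
      refine le_trans ?_ (exp_neg_one_le_pow hN (Finset.mem_range.1 hk).le)
      rw [Real.exp_neg, inv_eq_one_div]
      exact one_div_le_one_div_of_le (Real.exp_pos 1) Real.exp_one_lt_three.le
    have h6 : ‖X + Y‖ ^ 2 ≤ 2 * (‖X‖ ^ 2 + ‖Y‖ ^ 2) := by
      have := norm_add_le X Y
      nlinarith [norm_nonneg (X + Y), sq_nonneg (‖X‖ - ‖Y‖)]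
    have h7 : 1 ≤ 9 * (r ^ k) ^ 2 := by nlinarith
    have h8 : 0 ≤ ‖X‖ ^ 2 + ‖Y‖ ^ 2 := by positivity
    rw [mul_pow, mul_pow, ← add_mul]
    nlinarith
  have hsum := Finset.sum_le_sum hterm
  rw [← Finset.mul_sum, Finset.sum_add_distrib] at hsum
  -- The Parseval bounds total 18(2B² + 3) ε² q² N, and 36B² + 54 ≤ (6B + 8)².
  have hsq : ∑ k ∈ Finset.range N, (((k : ℝ) + 1) * ‖m (k + 1) - A * p (k + 1)‖) ^ 2
      ≤ N * (ε * (6 * B + 8) * q) ^ 2 := by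
    have hNr : (0 : ℝ) ≤ N := Nat.cast_nonneg N
    have h5 : q ^ 2 * (J * (2 * B) ^ 2) ≤ q ^ 2 * (ε ^ 2 * N) := by gcongr
    have h6 : 0 ≤ ε ^ 2 * q ^ 2 * N := by positivity
    have h7 : 0 ≤ ε ^ 2 * q ^ 2 * N * B := by positivity
    push_cast at h1'
    nlinarith
  have hcs := sq_sum_le_card_mul_sum_sq (s := Finset.range N)
    (f := fun k : ℕ => ((k : ℝ) + 1) * ‖m (k + 1) - A * p (k + 1)‖)
  rw [Finset.card_range] at hcs
  refine le_of_sq_le_sq (hcs.trans ?_) (by positivity)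
  calc _ ≤ (N : ℝ) * (N * (ε * (6 * B + 8) * q) ^ 2) := by gcongr
    _ = _ := by ring

end Twist

/-! ### From the mean to a single index -/

section Twist

variable {v p : ℕ → ℝ} {φ m : ℕ → ℂ} {θ B : ℝ}

theorem IsExpCoeff.norm_sub_mul_le (hp : IsExpCoeff v p)
    (hm : IsExpCoeff (fun i => (v i : ℂ) * φ i) m) (hv : ∀ i, 0 < v i) (hφ : ∀ i, ‖φ i‖ ≤ 1)
    {A : ℂ} (hA : ‖A‖ ≤ 1) (k : ℕ) : ‖m k - A * p k‖ ≤ 2 * p k := by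
  have h1 := hm.norm_le hp (norm_ofReal_mul_le hv hφ) k
  have h2 : ‖A * p k‖ ≤ p k := by
    rw [norm_mul, Complex.norm_real, Real.norm_of_nonneg (hp.pos hv k).le]
    exact mul_le_of_le_one_left (hp.pos hv k).le hA
  linarith [norm_sub_le (m k) (A * p k)]

/-- Summation of the differences of the two coefficient sequences, the indices up to `N / L` being
estimated trivially. -/
theorem IsExpCoeff.sum_norm_sub_le (hp : IsExpCoeff v p)
    (hm : IsExpCoeff (fun i => (v i : ℂ) * φ i) m) (hθ : 0 < θ) (hvθ : ∀ i, θ ≤ v i)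
    (hB : ∀ i, v i ≤ B) (hφ : ∀ i, ‖φ i‖ ≤ 1) {N L : ℕ} (hL : 1 ≤ L) (hLN : L ≤ N) {A : ℂ}
    (hA : ‖A‖ ≤ 1) {c : ℝ}
    (hc : ∑ k ∈ Finset.range N, ((k : ℝ) + 1) * ‖m (k + 1) - A * p (k + 1)‖ ≤ N * c) :
    ∑ k ∈ Finset.range N, ‖m k - A * p k‖
      ≤ 2 * (Real.exp 1 * (Real.exp 1 / L) ^ θ * ∑' n, p n * Real.exp (-1 / N) ^ n) + L * c := by
  have hv : ∀ i, 0 < v i := fun i => hθ.trans_le (hvθ i)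
  have hN0 : (0 : ℝ) < N := by exact_mod_cast hL.trans hLN
  rw [← Finset.sum_filter_add_sum_filter_not (Finset.range N) (fun k => k * L ≤ N)]
  refine add_le_add ?_ ?_
  · have h1 := hp.sum_le_rpow_mul_tsum hθ hvθ hB hL hLN
      ((Finset.range N).filter fun k => k * L ≤ N) fun k hk => (Finset.mem_filter.1 hk).2
    refine le_trans ?_ (mul_le_mul_of_nonneg_left h1 (by norm_num))
    rw [Finset.mul_sum]
    exact Finset.sum_le_sum fun k _ => hp.norm_sub_mul_le hm hv hφ hA k
  · have h1 : ∑ k ∈ (Finset.range N).filter (fun k => ¬ k * L ≤ N), N * ‖m k - A * p k‖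
        ≤ ∑ k ∈ Finset.range (N + 1), L * ((k : ℝ) * ‖m k - A * p k‖) := by
      refine (Finset.sum_le_sum fun k hk => ?_).trans (Finset.sum_le_sum_of_subset_of_nonneg
        ((Finset.filter_subset _ _).trans (Finset.range_mono (Nat.le_succ N)))
        fun k _ _ => by positivity)
      have h2 : (N : ℝ) ≤ k * L := by
        have := (Finset.mem_filter.1 hk).2
        exact_mod_cast (not_le.1 this).le
      calc _ ≤ (k * L : ℝ) * ‖m k - A * p k‖ := by gcongr
        _ = _ := by ring
    rw [← Finset.mul_sum, ← Finset.mul_sum, Finset.sum_range_succ'] at h1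
    push_cast at h1
    rw [zero_mul, add_zero] at h1
    have h2 : (L : ℝ) * ∑ k ∈ Finset.range N, ((k : ℝ) + 1) * ‖m (k + 1) - A * p (k + 1)‖
        ≤ L * (N * c) := by gcongr
    refine le_of_mul_le_mul_left ?_ hN0
    linarith

/-- Kernel indices from J on bring a factor ε against the whole sum of `p`. The fewer than J others
may have a large kernel, but pair with p_k of index near n, each O(q/n). -/
theorem IsExpCoeff.norm_sum_antidiagonal_le (hp : IsExpCoeff v p)
    (hm : IsExpCoeff (fun i => (v i : ℂ) * φ i) m) (hv : ∀ i, 0 < v i)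
    (hB : ∀ i, v i ≤ B) (hφ : ∀ i, ‖φ i‖ ≤ 1) {n J : ℕ} {ε : ℝ} (hε : 0 < ε)
    (hJ : ∀ i, J ≤ i → ‖(v i : ℂ) * (φ i - 1)‖ ≤ ε) (hJn : J * 2 ≤ n)
    (hJε : J * (2 * B * (2 * B * Real.exp 1)) ≤ ε * (n + 1 : ℕ)) :
    ‖∑ x ∈ Finset.HasAntidiagonal.antidiagonal n, ((v x.1 : ℂ) * (φ x.1 - 1)) * m x.2‖
      ≤ ε * (1 + Real.exp 1) * ∑' k, p k * Real.exp (-1 / (n + 1 : ℕ)) ^ k := by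
  set q := ∑' k, p k * Real.exp (-1 / (n + 1 : ℕ)) ^ k with hq
  have hq0 : 0 ≤ q := hp.tsum_nonneg hv (Real.exp_pos _).le
  have hB0 : 0 < B := (hv 0).trans_le (hB 0)
  have hmp := hm.norm_le hp (norm_ofReal_mul_le hv hφ)
  set b := 2 * B * (2 * B * Real.exp 1 / (n + 1 : ℕ) * q) with hb
  have hb0 : 0 ≤ b := by positivity
  have hterm : ∀ x ∈ Finset.HasAntidiagonal.antidiagonal n,
      ‖((v x.1 : ℂ) * (φ x.1 - 1)) * m x.2‖
        ≤ ε * p x.2 + if x.1 < J then b else 0 := by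
    intro x hx
    have hx := Finset.HasAntidiagonal.mem_antidiagonal.1 hx
    rw [norm_mul]
    split_ifs with h
    · have h1 := hp.le_of_le_mul hv hB (N := n + 1) (k := x.2) (by omega) (by omega) (by omega)
      have h2 : ‖(v x.1 : ℂ) * (φ x.1 - 1)‖ * ‖m x.2‖ ≤ b :=
        mul_le_mul (norm_mul_sub_one_le hv hB hφ _) ((hmp _).trans h1) (norm_nonneg _)
          (by positivity)
      have h3 := mul_nonneg hε.le (hp.pos hv x.2).le
      linarith
    · rw [add_zero]
      exact mul_le_mul (hJ _ (not_lt.1 h)) (hmp _) (norm_nonneg _) hε.le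
  have h1 : ∑ x ∈ Finset.HasAntidiagonal.antidiagonal n, (if x.1 < J then b else 0) ≤ ε * q := by
    rw [Finset.Nat.sum_antidiagonal_eq_sum_range_succ_mk]
    rw [← Finset.sum_filter, Finset.sum_const, nsmul_eq_mul]
    have hcard : (((Finset.range n.succ).filter fun k => k < J).card : ℝ) ≤ J := by
      have : ((Finset.range n.succ).filter fun k => k < J).card ≤ (Finset.range J).card :=
        Finset.card_le_card fun k hk => Finset.mem_range.2 (Finset.mem_filter.1 hk).2
      rw [Finset.card_range] at this
      exact_mod_cast this
    refine (mul_le_mul_of_nonneg_right hcard hb0).trans ?_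
    have hn : (0 : ℝ) < (n + 1 : ℕ) := by positivity
    have h2 : J * b = (J * (2 * B * (2 * B * Real.exp 1))) / (n + 1 : ℕ) * q := by
      rw [hb]; ring
    rw [h2]
    refine mul_le_mul_of_nonneg_right ?_ hq0
    rwa [div_le_iff₀ hn]
  refine (norm_sum_le _ _).trans ((Finset.sum_le_sum hterm).trans ?_)
  rw [Finset.sum_add_distrib, ← Finset.mul_sum, Finset.sum_antidiagonal_snd]
  have h2 := hp.sum_range_le_exp_mul_tsum hv hB (N := n + 1) (by omega)
  have h3 : ∑ k ∈ Finset.range (n + 1), p k ≤ ∑ k ∈ Finset.range (n + 1 + 1), p k :=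
    Finset.sum_le_sum_of_subset_of_nonneg (Finset.range_mono (by omega))
      fun i _ _ => (hp.pos hv i).le
  have h4 : ε * ∑ k ∈ Finset.range (n + 1), p k ≤ ε * (Real.exp 1 * q) := by
    have := h3.trans h2
    gcongr
  linarith

theorem tendsto_exp_neg_inv_nhdsLT :
    Tendsto (fun N : ℕ => Real.exp (-1 / (N : ℝ))) atTop (𝓝[<] 1) := by
  refine tendsto_nhdsWithin_iff.2 ⟨?_, ?_⟩
  · have h : Tendsto (fun N : ℕ => (-1 : ℝ) / N) atTop (𝓝 0) :=
      tendsto_const_div_atTop_nhds_zero_nat _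
    simpa [Function.comp_def] using (Real.continuous_exp.tendsto 0).comp h
  · filter_upwards [eventually_ge_atTop 1] with N hN
    exact exp_neg_inv_lt_one hN

theorem IsExpCoeff.eventually_mul_norm_sub_le (hp : IsExpCoeff v p)
    (hm : IsExpCoeff (fun i => (v i : ℂ) * φ i) m) (hθ : 0 < θ) (hθ1 : θ ≤ 1)
    (hvθ : ∀ i, θ ≤ v i) (hB : ∀ i, v i ≤ B) (hφ : ∀ i, ‖φ i‖ ≤ 1) (hlim : Tendsto φ atTop (𝓝 1))
    {τ : ℝ} (hτ : 0 < τ) :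
    ∀ᶠ N : ℕ in atTop,
      N * ‖m N - Complex.exp (twist v φ (Real.exp (-1 / (N : ℝ)) : ℝ)) * p N‖
        ≤ τ * ∑' n, p n * Real.exp (-1 / (N : ℝ)) ^ n := by
  have hv : ∀ i, 0 < v i := fun i => hθ.trans_le (hvθ i)
  have hB0 : 0 < B := (hv 0).trans_le (hB 0)
  have ha : Tendsto (fun i => (v i : ℂ) * (φ i - 1)) atTop (𝓝 0) := by
    have h1 : Tendsto (fun i => B * ‖φ i - 1‖) atTop (𝓝 0) := by
      have := ((hlim.sub_const 1).norm).const_mul B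
      simpa using this
    refine squeeze_zero_norm (fun i => ?_) h1
    rw [norm_mul, Complex.norm_real, Real.norm_of_nonneg (hv i).le]
    exact mul_le_mul_of_nonneg_right (hB i) (norm_nonneg _)
  -- L comes first: it makes the indices up to N/L cost at most τ/2. Only then is ε fixed, since its
  -- constant S contains L; ε S is the remaining τ/2.
  obtain ⟨L, hL1, hL⟩ : ∃ L : ℕ, 1 ≤ L ∧
      B * (2 * (Real.exp 1 * (Real.exp 1 / L) ^ θ)) ≤ τ / 2 := by
    have h1 : Tendsto (fun L : ℕ => Real.exp 1 / (L : ℝ)) atTop (𝓝 0) :=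
      tendsto_const_div_atTop_nhds_zero_nat _
    have h2 : Tendsto (fun L : ℕ => (Real.exp 1 / (L : ℝ)) ^ θ) atTop (𝓝 0) := by
      have := h1.rpow_const (p := θ) (Or.inr hθ.le)
      rwa [Real.zero_rpow hθ.ne'] at this
    have h3 : Tendsto (fun L : ℕ => B * (2 * (Real.exp 1 * (Real.exp 1 / (L : ℝ)) ^ θ))) atTop
        (𝓝 0) := by
      simpa using (((h2.const_mul (Real.exp 1)).const_mul 2).const_mul B)
    obtain ⟨L, h4, h5⟩ := ((h3.eventually (ge_mem_nhds (half_pos hτ))).and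
      (eventually_ge_atTop 1)).exists
    exact ⟨L, h5, h4⟩
  set S := B * L * (6 * B + 8) + 1 + Real.exp 1 with hS
  have hS0 : 0 < S := by positivity
  set ε := τ / 2 / S with hε
  have hε0 : 0 < ε := by positivity
  obtain ⟨J, hJ⟩ : ∃ J : ℕ, ∀ i, J ≤ i → ‖(v i : ℂ) * (φ i - 1)‖ ≤ ε := by
    have h := ha.norm
    rw [norm_zero] at h
    exact eventually_atTop.1 (h.eventually (ge_mem_nhds hε0))
  have hlarge : ∀ c b : ℝ, 0 < b → ∀ᶠ N : ℕ in atTop, c ≤ b * N := fun c b hb =>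
    (tendsto_natCast_atTop_atTop.const_mul_atTop hb).eventually_ge_atTop c
  filter_upwards [tendsto_exp_neg_inv_nhdsLT.eventually (hp.eventually_norm_sub_le hθ hθ1 hvθ hB
      (norm_mul_sub_one_le hv hB hφ) ha hε0), eventually_ge_atTop L,
      eventually_ge_atTop (J * 2 + 1), hlarge (J * (2 * B) ^ 2) (ε ^ 2) (by positivity),
      hlarge (J * (2 * B * (2 * B * Real.exp 1))) ε hε0] with N hW hNL hNJ hN1 hN2
  obtain ⟨n, rfl⟩ : ∃ n, N = n + 1 := ⟨N - 1, by omega⟩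
  set r := Real.exp (-1 / ((n + 1 : ℕ) : ℝ)) with hr
  have hr0 : 0 < r := Real.exp_pos _
  have hr1 : r < 1 := exp_neg_inv_lt_one (by omega)
  have hrn : ‖(r : ℂ)‖ = r := by rw [Complex.norm_real, Real.norm_of_nonneg hr0.le]
  set A := Complex.exp (twist v φ (r : ℝ)) with hA
  have hA1 : ‖A‖ ≤ 1 := norm_exp_twist_le_one hv hB hφ hr0.le hr1
  set q := ∑' k, p k * r ^ k with hq
  have hq0 : 0 ≤ q := hp.tsum_nonneg hv hr0.le
  have hvn : ∀ i, ‖(v i : ℂ)‖ ≤ v i := fun i => by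
    rw [Complex.norm_real, Real.norm_of_nonneg (hv i).le]
  have hsup : ∀ w : ℂ, ‖w‖ = 1 → ‖∑' k, (m k - A * p k) * ((r : ℂ) * w) ^ k‖ ≤ ε * q := by
    intro w hw
    have hz : ‖(r : ℂ) * w‖ = r := by rw [norm_mul, hrn, hw, mul_one]
    have hnorm : ∀ (c : ℕ → ℂ), (fun k => ‖c k * ((r : ℂ) * w) ^ k‖) = fun k => ‖c k‖ * r ^ k := by
      intro c; ext k; rw [norm_mul, norm_pow, hz]
    have sm : Summable fun k => m k * ((r : ℂ) * w) ^ k := Summable.of_norm (by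
      rw [hnorm]; exact hm.summable hp hv hB (norm_ofReal_mul_le hv hφ) hr0.le hr1)
    have sp : Summable fun k => (p k : ℂ) * ((r : ℂ) * w) ^ k := Summable.of_norm (by
      rw [hnorm fun k => (p k : ℂ)]; exact hp.ofReal.summable hp hv hB hvn hr0.le hr1)
    have h1 : ∑' k, (m k - A * p k) * ((r : ℂ) * w) ^ k
        = A * ((∑' k, (p k : ℂ) * ((r : ℂ) * w) ^ k) *
            (Complex.exp (twist v φ (r * w) - twist v φ r) - 1)) := by
      have h2 : ∀ k, (m k - A * p k) * ((r : ℂ) * w) ^ k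
          = m k * ((r : ℂ) * w) ^ k - A * (p k * ((r : ℂ) * w) ^ k) := fun k => by ring
      simp_rw [h2]
      rw [sm.tsum_sub (sp.mul_left A), tsum_mul_left,
        hp.tsum_eq_mul_exp_twist hm hv hB hφ (by rw [hz]; exact hr1), Complex.exp_sub, ← hA]
      have : A ≠ 0 := Complex.exp_ne_zero _
      field_simp
    rw [h1, norm_mul, norm_mul]
    exact (mul_le_of_le_one_left (by positivity) hA1).trans (hW w hw)
  have hmean := hp.sum_norm_le_of_norm_sub_le hm hv hB hφ (N := n + 1) (by omega) hε0 hJ hN1 hq hsup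
  have hsum := hp.sum_norm_sub_le hm hθ hvθ hB hφ hL1 hNL hA1 hmean
  have hc2 := hp.norm_sum_antidiagonal_le hm hv hB hφ hε0 hJ (by omega) hN2
  rw [← hr, ← hq] at hsum hc2
  have hc1 : ‖∑ x ∈ Finset.HasAntidiagonal.antidiagonal n, (v x.1 : ℂ) * (m x.2 - A * p x.2)‖
      ≤ B * ∑ k ∈ Finset.range (n + 1), ‖m k - A * p k‖ := by
    rw [← Finset.sum_antidiagonal_snd, Finset.mul_sum]
    refine (norm_sum_le _ _).trans (Finset.sum_le_sum fun x _ => ?_)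
    rw [norm_mul]
    exact mul_le_mul_of_nonneg_right ((hvn _).trans (hB _)) (norm_nonneg _)
  have hleft : ((n + 1 : ℕ) : ℝ) * ‖m (n + 1) - A * p (n + 1)‖
      = ‖(∑ x ∈ Finset.HasAntidiagonal.antidiagonal n, (v x.1 : ℂ) * (m x.2 - A * p x.2))
        + ∑ x ∈ Finset.HasAntidiagonal.antidiagonal n, ((v x.1 : ℂ) * (φ x.1 - 1)) * m x.2‖ := by
    rw [← hp.succ_mul_sub hm, norm_mul]
    congr 1
    exact_mod_cast (Complex.norm_natCast (n + 1)).symm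
  rw [hleft]
  calc _ ≤ B * (2 * (Real.exp 1 * (Real.exp 1 / L) ^ θ * q) + L * (ε * (6 * B + 8) * q))
        + ε * (1 + Real.exp 1) * q := by
        refine (norm_add_le _ _).trans (add_le_add (hc1.trans ?_) hc2)
        gcongr
    _ = (B * (2 * (Real.exp 1 * (Real.exp 1 / L) ^ θ)) + ε * S) * q := by rw [hS]; ring
    _ ≤ τ * q := by
        have : ε * S = τ / 2 := by rw [hε]; field_simp
        gcongr
        linarith

/-- The ratio of the two coefficient sequences is asymptotic to the exponential of the twist at
`e^{-1/N}`, up to an error tending to zero. -/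
theorem IsExpCoeff.tendsto_div_sub_exp_twist (hp : IsExpCoeff v p)
    (hm : IsExpCoeff (fun i => (v i : ℂ) * φ i) m) (hθ : 0 < θ) (hvθ : ∀ i, θ ≤ v i)
    (hB : ∀ i, v i ≤ B) (hφ : ∀ i, ‖φ i‖ ≤ 1) (hlim : Tendsto φ atTop (𝓝 1)) :
    Tendsto (fun N : ℕ => m N / p N - Complex.exp (twist v φ (Real.exp (-1 / (N : ℝ)) : ℝ)))
      atTop (𝓝 0) := by
  have hv : ∀ i, 0 < v i := fun i => hθ.trans_le (hvθ i)
  obtain ⟨C, hC0, hC⟩ := hp.exists_tsum_le hθ hvθ hB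
  rw [Metric.tendsto_nhds]
  intro τ hτ
  -- A smaller lower bound for `v` is still valid, so θ may be replaced by min θ 1.
  filter_upwards [hp.eventually_mul_norm_sub_le hm (lt_min hθ one_pos) (min_le_right θ 1)
    (fun i => (min_le_left θ 1).trans (hvθ i)) hB hφ hlim (τ := τ / 2 / C) (by positivity),
    eventually_ge_atTop 1] with N hN hN1
  have hN0 : (0 : ℝ) < N := by exact_mod_cast hN1
  have hpN := hp.pos hv N
  have hpc : (p N : ℂ) ≠ 0 := by exact_mod_cast hpN.ne'
  set A := Complex.exp (twist v φ (Real.exp (-1 / (N : ℝ)) : ℝ)) with hA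
  have h1 : m N / p N - A = (m N - A * p N) / p N := by field_simp
  rw [dist_zero_right, h1, norm_div, Complex.norm_real, Real.norm_of_nonneg hpN.le,
    div_lt_iff₀ hpN]
  have h2 : τ / 2 / C * ∑' n, p n * Real.exp (-1 / (N : ℝ)) ^ n ≤ τ / 2 / C * (C * (N * p N)) := by
    have := hC N hN1
    gcongr
  have h3 : τ / 2 / C * (C * (N * p N)) = N * (τ / 2 * p N) := by field_simp
  have h4 : ‖m N - A * p N‖ ≤ τ / 2 * p N := by
    refine le_of_mul_le_mul_left ?_ hN0
    linarith
  nlinarith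

end Twist

/-! ### Return to the symmetric group -/

theorem multFun_mul {R : Type*} [CommMonoid R] (g h : ℕ → R) {n : ℕ} (σ : Equiv.Perm (Fin n)) :
    multFun (fun j => g j * h j) σ = multFun g σ * multFun h σ := by
  simp only [multFun, mul_pow, Finset.prod_mul_distrib]

theorem multFun_ofReal (d : ℕ → ℝ) {n : ℕ} (σ : Equiv.Perm (Fin n)) :
    multFun (fun j => (d j : ℂ)) σ = ((multFun d σ : ℝ) : ℂ) := by
  simp only [multFun]
  push_cast
  rfl

theorem isExpCoeff_sum_multFun {K : Type*} [Field K] [CharZero K] (g : ℕ → K) :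
    IsExpCoeff (fun i => g (i + 1))
      fun n => (∑ σ : Equiv.Perm (Fin n), multFun g σ) / (n.factorial : K) :=
  ⟨sum_multFun_zero g, sum_multFun_div_factorial_succ g⟩

theorem weightedMean_eq_div (d : ℕ → ℝ) (f : ℕ → ℂ) (n : ℕ) :
    weightedMean d f n = (∑ σ : Equiv.Perm (Fin n), multFun f σ * ((multFun d σ : ℝ) : ℂ)) /
      (∑ σ : Equiv.Perm (Fin n), ((multFun d σ : ℝ) : ℂ)) := by
  rw [weightedMean, Finset.sum_div]
  refine Finset.sum_congr rfl fun σ _ => ?_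
  rw [permWeight]
  push_cast
  rw [mul_div_assoc]

theorem expSeriesTerm_succ_eq (d : ℕ → ℝ) (f : ℕ → ℂ) (n j : ℕ) :
    expSeriesTerm d f n (j + 1) = ((d (j + 1) : ℂ) * (f (j + 1) - 1)) *
      ((Real.exp (-1 / (n : ℝ)) : ℝ) : ℂ) ^ (j + 1) / ((j : ℂ) + 1) := by
  have h : Real.exp (-((j + 1 : ℕ) : ℝ) / (n : ℝ)) = Real.exp (-1 / (n : ℝ)) ^ (j + 1) := by
    rw [exp_neg_inv_pow, neg_div]
  rw [expSeriesTerm, h, Complex.ofReal_pow]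
  push_cast
  ring

theorem mainTheorem9 (d : ℕ → ℝ) (dlo dhi : ℝ) (hdlo : 0 < dlo)
    (hd : ∀ j : ℕ, 1 ≤ j → dlo ≤ d j ∧ d j ≤ dhi)
    (f : ℕ → ℂ) (hf : ∀ j : ℕ, 1 ≤ j → ‖f j‖ ≤ 1)
    (hlim : Tendsto f atTop (𝓝 1)) :
    (∀ n : ℕ, 1 ≤ n → weightedMean d f n =
      (∑ σ : Equiv.Perm (Fin n), multFun f σ * ((multFun d σ : ℝ) : ℂ)) /
        (∑ σ : Equiv.Perm (Fin n), ((multFun d σ : ℝ) : ℂ))) ∧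
    (∀ n : ℕ, 1 ≤ n → Summable (fun j : ℕ => expSeriesTerm d f n (j + 1))) ∧
    Tendsto (fun n : ℕ =>
      weightedMean d f n - Complex.exp (∑' j : ℕ, expSeriesTerm d f n (j + 1)))
      atTop (𝓝 0) := by
  have hlo : ∀ i, dlo ≤ d (i + 1) := fun i => (hd _ i.succ_pos).1
  have hhi : ∀ i, d (i + 1) ≤ dhi := fun i => (hd _ i.succ_pos).2
  have hpos : ∀ i, 0 < d (i + 1) := fun i => hdlo.trans_le (hlo i)
  have hf1 : ∀ i, ‖f (i + 1)‖ ≤ 1 := fun i => hf _ i.succ_pos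
  refine ⟨fun n _ => weightedMean_eq_div d f n, fun n hn => ?_, ?_⟩
  · simp_rw [expSeriesTerm_succ_eq]
    refine summable_mul_pow_succ_div (u := fun i => (d (i + 1) : ℂ) * (f (i + 1) - 1))
      (norm_mul_sub_one_le hpos hhi hf1) ?_
    rw [Complex.norm_real, Real.norm_of_nonneg (Real.exp_pos _).le]
    exact exp_neg_inv_lt_one hn
  · have hp := isExpCoeff_sum_multFun d
    have hm := isExpCoeff_sum_multFun fun j => (d j : ℂ) * f j
    have h := hp.tendsto_div_sub_exp_twist hm hdlo hlo hhi hf1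
      ((tendsto_add_atTop_iff_nat 1).2 hlim)
    refine h.congr fun n => ?_
    -- The normalising factors n! cancel in the ratio of the two coefficients.
    have hn : (n.factorial : ℂ) ≠ 0 := by exact_mod_cast n.factorial_ne_zero
    congr 1
    · rw [weightedMean_eq_div]
      push_cast
      rw [div_div_div_cancel_right₀ hn]
      congr 1
      refine Finset.sum_congr rfl fun σ _ => ?_
      rw [multFun_mul, multFun_ofReal, mul_comm]
    · rw [twist]
      simp_rw [expSeriesTerm_succ_eq]
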